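/- Let $k$ be a field and let $R=\bigoplus_{j\ge 0}R_j$ be a right Noetherian $\mathbb N$-graded $k$-algebra. Let $\mathrm{Gr}(R)$ be the category of $\mathbb Z$-graded right $R$-modules with morphisms of degree $0$, let $\mathrm{Tor}(R)$ be its full subcategory of torsion modules (those $M$ such that every $x\in M$ satisfies $xR_{\ge s}=0$ for some $s$), and let $\pi:\mathrm{Gr}(R)\to \mathrm{QGr}(R)=\mathrm{Gr}(R)/\mathrm{Tor}(R)$ be the quotient functor. The shift $M\mapsto M[n]$, $M[n]_i=M_{n+i}$, induces a shift on $\mathrm{QGr}(R)$. Let $\mathcal R=\pi(R)$ be the image of the right module $R$, so that $\mathrm{Proj}\,R$ is the triple consisting of $\mathrm{QGr}(R)$, $\mathcal R$ and the shift, and let $\mathrm{qgr}(R)$ be the full subcategory of Noetherian objects of $\mathrm{QGr}(R)$. For $i\ge 0$ and $\mathcal M\in\mathrm{QGr}(R)$ put $$H^i(\mathcal M)=\mathrm{Ext}^i_{\mathrm{QGr}(R)}(\mathcal R,\mathcal M),\qquad \underline H^i(\mathcal M)=\bigoplus_{n\in\mathbb Z}H^i(\mathcal M[n]),$$ write $\underline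 H^i(R)$ for $\underline H^i(\mathcal R)$, and define the cohomological dimension $$cd(\mathrm{Proj}\,R)=\sup\{i : H^i(\mathcal M)\neq 0\text{ for some }\mathcal M\in\mathrm{qgr}(R)\}\in\{-\infty\}\cup\mathbb N\cup\{\infty\},$$ where $\sup\emptyset=-\infty$. Then: 1. If $cd(\mathrm{Proj}\,R)<\infty$, then $cd(\mathrm{Proj}\,R)=\sup\{i:\underline H^i(R)\neq 0\}$. 2. If $R$ has left global dimension $d<\infty$, then $cd(\mathrm{Proj}\,R)\le d-1$. -/

import Mathlib

open CategoryTheory CategoryTheory.Limits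
open scoped DirectSum ZeroObject

universe w u

namespace NCProj

/-! ### Graded right modules -/

section GradedModules

variable {k : Type w} [Field k] {R : Type u} [Ring R] [Algebra k R]

/-- A `ℤ`-graded right module over the `ℕ`-graded algebra `R = ⨁ 𝒜 j`, given by its homogeneous
components `M_i` and the biadditive actions `M_i × R_j → M_{i+j}`.  (The index `l = i + j` of the
target is a variable, so that no transport along equalities of indices is needed.) -/
structure GrMod (𝒜 : ℕ → Submodule k R) [GradedAlgebra 𝒜] : Type (max w (u + 1)) where
  obj : ℤ → Type u
  [addCommGroup : ∀ i, AddCommGroup (obj i)]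
  act : ∀ {i : ℤ} {j : ℕ} {l : ℤ}, i + j = l → obj i →+ 𝒜 j →+ obj l
  act_one : ∀ {i : ℤ} (h : i + (0 : ℕ) = i) (m : obj i),
    act h m ⟨1, SetLike.GradedOne.one_mem⟩ = m
  act_mul : ∀ {i l n : ℤ} {j j' : ℕ} (h₁ : i + j = l) (h₂ : l + j' = n)
    (h₃ : i + (j + j' : ℕ) = n) (m : obj i) (a : 𝒜 j) (b : 𝒜 j'),
    act h₂ (act h₁ m a) b = act h₃ m ⟨(a : R) * (b : R), SetLike.GradedMul.mul_mem a.2 b.2⟩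

attribute [instance] GrMod.addCommGroup

variable {𝒜 : ℕ → Submodule k R} [GradedAlgebra 𝒜]

namespace GrMod

/-- Morphisms of graded right modules: right linear maps of degree `0`. -/
@[ext]
structure Hom (M N : GrMod 𝒜) : Type u where
  app : ∀ i, M.obj i →+ N.obj i
  map_act : ∀ {i : ℤ} {j : ℕ} {l : ℤ} (h : i + j = l) (m : M.obj i) (a : 𝒜 j),
    app l (M.act h m a) = N.act h (app i m) a

/-- The category `Gr(R)` of `ℤ`-graded right `R`-modules. -/
instance : Category.{u} (GrMod 𝒜) where
  Hom M N := Hom M N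
  id M := { app := fun i => AddMonoidHom.id _, map_act := fun _ _ _ => rfl }
  comp f g :=
    { app := fun i => (g.app i).comp (f.app i)
      map_act := fun h m a => by simp [f.map_act, g.map_act] }

variable {M N L : GrMod 𝒜}

@[ext]
lemma hom_ext {f g : M ⟶ N} (h : ∀ i x, f.app i x = g.app i x) : f = g :=
  Hom.ext (funext fun i => AddMonoidHom.ext (h i))

@[simp] lemma id_app (i : ℤ) (x : M.obj i) : Hom.app (𝟙 M) i x = x := rfl

@[simp] lemma comp_app (f : M ⟶ N) (g : N ⟶ L) (i : ℤ) (x : M.obj i) :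
    (f ≫ g).app i x = g.app i (f.app i x) := rfl

lemma congr_app {f g : M ⟶ N} (h : f = g) (i : ℤ) (x : M.obj i) : f.app i x = g.app i x := by
  rw [h]

instance : Zero (M ⟶ N) := ⟨{ app := fun _ => 0, map_act := fun _ _ _ => by simp }⟩
instance : Add (M ⟶ N) :=
  ⟨fun f g => { app := fun i => f.app i + g.app i
                map_act := fun h m a => by simp [f.map_act, g.map_act] }⟩
instance : Neg (M ⟶ N) :=
  ⟨fun f => { app := fun i => - f.app i, map_act := fun h m a => by simp [f.map_act] }⟩

@[simp] lemma zero_app (i : ℤ) (x : M.obj i) : Hom.app (0 : M ⟶ N) i x = 0 := rfl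
@[simp] lemma add_app (f g : M ⟶ N) (i : ℤ) (x : M.obj i) :
    Hom.app (f + g) i x = f.app i x + g.app i x := rfl
@[simp] lemma neg_app (f : M ⟶ N) (i : ℤ) (x : M.obj i) :
    Hom.app (-f) i x = - f.app i x := rfl

instance : AddCommGroup (M ⟶ N) where
  add_assoc f g h := by ext; simp [add_assoc]
  zero_add f := by ext; simp
  add_zero f := by ext; simp
  nsmul := nsmulRec
  zsmul := zsmulRec
  neg_add_cancel f := by ext; simp
  add_comm f g := by ext; simp [add_comm]

instance : Preadditive (GrMod 𝒜) where
  add_comp _ _ _ f g h := by ext; simp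
  comp_add _ _ _ f g h := by ext; simp

/-! Kernels, cokernels and products are formed degree by degree. -/

/-- The kernel of a morphism of graded modules. -/
def ker (f : M ⟶ N) : GrMod 𝒜 where
  obj i := (f.app i).ker
  act {i j l} h :=
    { toFun := fun m =>
        { toFun := fun a => ⟨M.act h m a, by
            have hm : f.app i m = 0 := m.2
            simp [AddMonoidHom.mem_ker, f.map_act, hm]⟩
          map_zero' := by ext; simp
          map_add' := fun _ _ => by ext; simp }
      map_zero' := by ext; simp
      map_add' := fun _ _ => by ext; simp }
  act_one h m := Subtype.ext (M.act_one h m)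
  act_mul h₁ h₂ h₃ m a b := Subtype.ext (M.act_mul h₁ h₂ h₃ m a b)

/-- The inclusion of the kernel. -/
def kerι (f : M ⟶ N) : ker f ⟶ M where
  app i := (f.app i).ker.subtype
  map_act _ _ _ := rfl

lemma kerι_comp (f : M ⟶ N) : kerι f ≫ f = 0 := by
  ext i x
  exact x.2

/-- The universal property of the kernel. -/
def kerIsLimit (f : M ⟶ N) : IsLimit (KernelFork.ofι (kerι f) (kerι_comp f)) :=
  KernelFork.IsLimit.ofι _ _
    (fun {W'} g hg =>
      { app := fun i => (g.app i).codRestrict _ (fun x => congr_app hg i x)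
        map_act := fun h m a => Subtype.ext (g.map_act h m a) })
    (fun g hg => rfl)
    (fun g hg m hm => by
      ext i x
      exact Subtype.ext (congr_app hm i x))

/-- The cokernel of a morphism of graded modules. -/
def coker (f : M ⟶ N) : GrMod 𝒜 where
  obj i := N.obj i ⧸ (f.app i).range
  act {i j l} h := QuotientAddGroup.lift _
    { toFun := fun m => (QuotientAddGroup.mk' (f.app l).range).comp (N.act h m)
      map_zero' := by ext; simp
      map_add' := fun _ _ => by ext; simp }
    (by
      rintro _ ⟨m, rfl⟩
      ext a
      exact (QuotientAddGroup.eq_zero_iff _).2 ⟨M.act h m a, f.map_act h m a⟩)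
  act_one h m := by
    obtain ⟨m, rfl⟩ := QuotientAddGroup.mk_surjective m
    exact congrArg QuotientAddGroup.mk (N.act_one h m)
  act_mul h₁ h₂ h₃ m a b := by
    obtain ⟨m, rfl⟩ := QuotientAddGroup.mk_surjective m
    exact congrArg QuotientAddGroup.mk (N.act_mul h₁ h₂ h₃ m a b)

/-- The projection onto the cokernel. -/
def cokerπ (f : M ⟶ N) : N ⟶ coker f where
  app i := QuotientAddGroup.mk' (f.app i).range
  map_act _ _ _ := rfl

lemma cokerπ_surjective (f : M ⟶ N) (i : ℤ) : Function.Surjective ((cokerπ f).app i) :=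
  QuotientAddGroup.mk_surjective

lemma cokerπ_eq_zero_iff (f : M ⟶ N) (i : ℤ) (x : N.obj i) :
    (cokerπ f).app i x = 0 ↔ ∃ y, f.app i y = x :=
  QuotientAddGroup.eq_zero_iff _

lemma comp_cokerπ (f : M ⟶ N) : f ≫ cokerπ f = 0 := by
  ext i x
  exact (cokerπ_eq_zero_iff f i _).2 ⟨x, rfl⟩

/-- The universal property of the cokernel. -/
def cokerIsColimit (f : M ⟶ N) :
    IsColimit (CokernelCofork.ofπ (cokerπ f) (comp_cokerπ f)) :=
  CokernelCofork.IsColimit.ofπ _ _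
    (fun {Z'} g hg =>
      { app := fun i => QuotientAddGroup.lift _ (g.app i) (by
          rintro _ ⟨m, rfl⟩
          exact congr_app hg i m)
        map_act := fun {i j l} h m a => by
          obtain ⟨m, rfl⟩ := QuotientAddGroup.mk_surjective m
          exact g.map_act h m a })
    (fun g hg => rfl)
    (fun g hg m hm => by
      ext i x
      obtain ⟨x, rfl⟩ := QuotientAddGroup.mk_surjective x
      exact congr_app hm i x)

/-- The product of a family of graded modules. -/
def pi {J : Type} (F : J → GrMod 𝒜) : GrMod 𝒜 where
  obj i := ∀ j, (F j).obj i
  act h :=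
    { toFun := fun m =>
        { toFun := fun a t => (F t).act h (m t) a
          map_zero' := by ext; simp
          map_add' := fun _ _ => by ext; simp }
      map_zero' := by ext; simp
      map_add' := fun _ _ => by ext; simp }
  act_one h m := funext fun t => (F t).act_one h (m t)
  act_mul h₁ h₂ h₃ m a b := funext fun t => (F t).act_mul h₁ h₂ h₃ (m t) a b

/-- The product cone. -/
def piFan {J : Type} (F : J → GrMod 𝒜) : Fan F :=
  Fan.mk (pi F) fun t =>
    { app := fun i => Pi.evalAddMonoidHom (fun j => (F j).obj i) t, map_act := fun _ _ _ => rfl }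

/-- The universal property of the product. -/
def piFanIsLimit {J : Type} (F : J → GrMod 𝒜) : IsLimit (piFan F) :=
  Fan.IsLimit.mk _
    (fun s =>
      { app := fun i => AddMonoidHom.mk' (fun x t => (s.proj t).app i x)
          (fun x y => funext fun t => map_add _ x y)
        map_act := fun h m a => funext fun t => (s.proj t).map_act h m a })
    (fun s t => rfl)
    (fun s m hm => by
      ext i x
      exact funext fun t => congr_app (hm t) i x)

instance : HasKernels (GrMod 𝒜) := ⟨fun f => ⟨⟨_, kerIsLimit f⟩⟩⟩
instance : HasCokernels (GrMod 𝒜) := ⟨fun f => ⟨⟨_, cokerIsColimit f⟩⟩⟩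
instance : HasFiniteProducts (GrMod 𝒜) :=
  have : HasProducts.{0} (GrMod 𝒜) :=
    hasProducts_of_limit_fans (fun F => piFan F) (fun F => piFanIsLimit F)
  hasFiniteProducts_of_hasProducts _

lemma injective_of_mono (f : M ⟶ N) [Mono f] (i : ℤ) : Function.Injective (f.app i) := by
  have h : kerι f = 0 := by rw [← cancel_mono f, kerι_comp, zero_comp]
  exact (injective_iff_map_eq_zero _).2 fun x hx => congr_app h i ⟨x, hx⟩

lemma surjective_of_epi (f : M ⟶ N) [Epi f] (i : ℤ) : Function.Surjective (f.app i) := by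
  have h : cokerπ f = 0 := by rw [← cancel_epi f, comp_cokerπ, comp_zero]
  exact fun x => (cokerπ_eq_zero_iff f i x).1 (congr_app h i x)

instance : IsNormalMonoCategory (GrMod 𝒜) where
  normalMonoOfMono {M N} f _ := ⟨
    { Z := coker f
      g := cokerπ f
      w := comp_cokerπ f
      isLimit := by
        have hr : ∀ {W : GrMod 𝒜} (g : W ⟶ N) (_ : g ≫ cokerπ f = 0) (i : ℤ) (x : W.obj i),
            ∃ y, f.app i y = g.app i x :=
          fun g hg i x => (cokerπ_eq_zero_iff f i _).1 (congr_app hg i x)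
        refine KernelFork.IsLimit.ofι _ _
          (fun {W} g hg =>
            { app := fun i => AddMonoidHom.mk' (fun x => (hr g hg i x).choose) (fun x y => ?_)
              map_act := fun {i j l} h m a => ?_ }) (fun {W} g hg => ?_) (fun {W} g hg m hm => ?_)
        · apply injective_of_mono f
          exact (hr g hg i _).choose_spec.trans ((map_add (g.app i) x y).trans
            ((map_add (f.app i) _ _).trans
              (congrArg₂ _ (hr g hg i x).choose_spec (hr g hg i y).choose_spec)).symm)
        · apply injective_of_mono f
          rw [f.map_act]
          change f.app l (hr g hg l _).choose = N.act h (f.app i (hr g hg i _).choose) a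
          rw [(hr g hg i _).choose_spec, (hr g hg l _).choose_spec, g.map_act]
        · ext i x
          exact (hr g hg i x).choose_spec
        · ext i x
          apply injective_of_mono f
          exact (congr_app hm i x).trans (hr g hg i x).choose_spec.symm }⟩

instance : IsNormalEpiCategory (GrMod 𝒜) where
  normalEpiOfEpi {M N} f _ := ⟨
    { W := ker f
      g := kerι f
      w := kerι_comp f
      isColimit := by
        have hs := surjective_of_epi f
        have hk : ∀ {Z : GrMod 𝒜} (g : M ⟶ Z) (_ : kerι f ≫ g = 0) (i : ℤ) (x y : M.obj i),
            f.app i x = f.app i y → g.app i x = g.app i y := fun g hg i x y hxy => by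
          have : f.app i (x - y) = 0 := by rw [map_sub, hxy, sub_self]
          have h2 : g.app i (x - y) = 0 := congr_app hg i ⟨x - y, this⟩
          rwa [map_sub, sub_eq_zero] at h2
        refine CokernelCofork.IsColimit.ofπ _ _
          (fun {Z} g hg =>
            { app := fun i => AddMonoidHom.mk' (fun x => g.app i (hs i x).choose) (fun x y => ?_)
              map_act := fun {i j l} h m a => ?_ }) (fun {Z} g hg => ?_) (fun {Z} g hg m hm => ?_)
        · rw [← map_add]
          apply hk g hg
          rw [map_add, (hs i _).choose_spec, (hs i _).choose_spec, (hs i _).choose_spec]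
        · change g.app l (hs l _).choose = Z.act h (g.app i (hs i m).choose) a
          rw [← g.map_act]
          apply hk g hg
          rw [f.map_act, (hs i _).choose_spec, (hs l _).choose_spec]
        · ext i x
          exact hk g hg i _ _ (hs i _).choose_spec
        · ext i x
          obtain ⟨x, rfl⟩ := hs i x
          refine (congr_app hm i x).trans (hk g hg i _ _ (hs i _).choose_spec.symm) }⟩

instance : Abelian (GrMod 𝒜) where

/-- The shift `M ↦ M[n]`, with `M[n]_i = M_{n+i}`. -/
def shift (𝒜 : ℕ → Submodule k R) [GradedAlgebra 𝒜] (n : ℤ) : GrMod 𝒜 ⥤ GrMod 𝒜 where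
  obj M :=
    { obj := fun i => M.obj (n + i)
      act := fun {i j l} h => M.act (i := n + i) (l := n + l) (by rw [add_assoc, h])
      act_one := fun _ m => M.act_one _ m
      act_mul := fun _ _ _ m a b => M.act_mul _ _ _ m a b }
  map f :=
    { app := fun i => f.app (n + i)
      map_act := fun _ m a => f.map_act _ m a }

/-- The degree `i` component of `R`, for `i : ℤ` (zero if `i < 0`). -/
def intPiece (𝒜 : ℕ → Submodule k R) : ℤ → Submodule k R
  | Int.ofNat n => 𝒜 n
  | Int.negSucc _ => ⊥

lemma mul_mem_intPiece {i : ℤ} {j : ℕ} {l : ℤ} (h : i + j = l) {x a : R}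
    (hx : x ∈ intPiece 𝒜 i) (ha : a ∈ 𝒜 j) : x * a ∈ intPiece 𝒜 l := by
  subst h
  cases i with
  | ofNat n => exact SetLike.GradedMul.mul_mem (A := 𝒜) hx ha
  | negSucc n =>
    have hx : x = 0 := hx
    simp [hx]

/-- `R` as a graded right module over itself. -/
def self (𝒜 : ℕ → Submodule k R) [GradedAlgebra 𝒜] : GrMod 𝒜 where
  obj i := intPiece 𝒜 i
  act h :=
    { toFun := fun m =>
        { toFun := fun a => ⟨(m : R) * (a : R), mul_mem_intPiece h m.2 a.2⟩
          map_zero' := by ext; simp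
          map_add' := fun _ _ => by ext; simp [mul_add] }
      map_zero' := by ext; simp
      map_add' := fun _ _ => by ext; simp [add_mul] }
  act_one _ m := Subtype.ext (mul_one (m : R))
  act_mul _ _ _ m a b := Subtype.ext (mul_assoc (m : R) (a : R) (b : R))

/-- A graded module is torsion if each of its homogeneous elements `x` satisfies `x R_{≥ s} = 0`
for some `s`.  (Equivalently, each of its elements does, as an element has finitely many
homogeneous components.) -/
def torsion (𝒜 : ℕ → Submodule k R) [GradedAlgebra 𝒜] : ObjectProperty (GrMod 𝒜) :=
  fun M => ∀ (i : ℤ) (x : M.obj i), ∃ s : ℕ, ∀ (j : ℕ), s ≤ j → ∀ (a : 𝒜 j) (l : ℤ) (h : i + j = l),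
    M.act h x a = 0

lemma torsion_of_injective (f : M ⟶ N) (hf : ∀ i, Function.Injective (f.app i))
    (hN : torsion 𝒜 N) : torsion 𝒜 M := fun i x => by
  obtain ⟨s, hs⟩ := hN i (f.app i x)
  refine ⟨s, fun j hj a l h => hf l ?_⟩
  rw [f.map_act, hs j hj, map_zero]

lemma torsion_of_surjective (f : M ⟶ N) (hf : ∀ i, Function.Surjective (f.app i))
    (hM : torsion 𝒜 M) : torsion 𝒜 N := fun i x => by
  obtain ⟨x, rfl⟩ := hf i x
  obtain ⟨s, hs⟩ := hM i x
  refine ⟨s, fun j hj a l h => ?_⟩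
  rw [← f.map_act, hs j hj, map_zero]

lemma exists_generators [IsNoetherianRing Rᵐᵒᵖ] (s : ℕ) :
    ∃ (S : Finset R) (d : R → ℕ), (∀ a ∈ S, s ≤ d a ∧ a ∈ 𝒜 (d a)) ∧
      ∀ n, s ≤ n → (∀ a ∈ S, d a ≤ n) → ∀ b ∈ 𝒜 n,
        ∃ c : R → R, (∀ a ∈ S, c a ∈ 𝒜 (n - d a)) ∧ b = ∑ a ∈ S, a * c a := by
  classical
  let H : Set R := {a | ∃ j, s ≤ j ∧ a ∈ 𝒜 j}
  have : IsNoetherian Rᵐᵒᵖ R := isNoetherian_of_surjective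
    ({ toFun := MulOpposite.unop, map_add' := fun _ _ => rfl, map_smul' := fun _ _ => rfl } :
      Rᵐᵒᵖ →ₗ[Rᵐᵒᵖ] R) (LinearMap.range_eq_top.2 MulOpposite.unop_surjective)
  have hfg : (Submodule.span Rᵐᵒᵖ H).FG := IsNoetherian.noetherian _
  obtain ⟨S, hSH, hS⟩ := Submodule.fg_span_iff_fg_span_finset_subset H |>.1 hfg
  have hd : ∀ a : R, ∃ j, a ∈ S → s ≤ j ∧ a ∈ 𝒜 j := fun a => by
    by_cases ha : a ∈ S
    · obtain ⟨j, hj⟩ := hSH ha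
      exact ⟨j, fun _ => hj⟩
    · exact ⟨0, fun h => (ha h).elim⟩
  choose d hd using hd
  refine ⟨S, d, hd, fun n hn hdn b hb => ?_⟩
  have hbS : b ∈ Submodule.span Rᵐᵒᵖ (S : Set R) := hS ▸ Submodule.subset_span ⟨n, hn, hb⟩
  obtain ⟨f, -, hf⟩ := Submodule.mem_span_finset.1 hbS
  refine ⟨fun a => (DirectSum.decompose 𝒜 (f a).unop (n - d a) : R), fun a _ => SetLike.coe_mem _, ?_⟩
  have h1 : (DirectSum.decompose 𝒜 b n : R) = b := DirectSum.decompose_of_mem_same 𝒜 hb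
  rw [← h1, ← hf, DirectSum.decompose_sum, DFinsupp.finsetSum_apply, AddSubmonoidClass.coe_finsetSum]
  refine Finset.sum_congr rfl fun a ha => ?_
  exact DirectSum.coe_decompose_mul_of_left_mem_of_le 𝒜 (hd a ha).2 (hdn a ha)

lemma torsion_of_extension [IsNoetherianRing Rᵐᵒᵖ] (f : M ⟶ N) (g : N ⟶ L)
    (hfg : ∀ i x, g.app i x = 0 → ∃ y, f.app i y = x)
    (hM : torsion 𝒜 M) (hL : torsion 𝒜 L) : torsion 𝒜 N := fun i x => by
  obtain ⟨s, hs⟩ := hL i (g.app i x)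
  obtain ⟨S, d, hS, hgen⟩ := exists_generators (𝒜 := 𝒜) s
  have ht : ∀ a : S, ∃ t : ℕ, ∀ j, t ≤ j → ∀ (c : 𝒜 j) (l : ℤ) (h : i + d a + j = l),
      N.act h (N.act rfl x ⟨(a : R), (hS a a.2).2⟩) c = 0 := fun a => by
    obtain ⟨y, hy⟩ := hfg (i + d a) (N.act rfl x ⟨(a : R), (hS a a.2).2⟩) (by
      rw [g.map_act]
      exact hs _ (hS a a.2).1 _ _ _)
    obtain ⟨t, ht⟩ := hM _ y
    refine ⟨t, fun j hj c l h => ?_⟩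
    rw [← hy, ← f.map_act, ht j hj, map_zero]
  choose t ht using ht
  refine ⟨s + ∑ a : S, (d a + t a), fun n hn b l h => ?_⟩
  have hle : ∀ a : S, d a + t a ≤ n := fun a =>
    (Finset.single_le_sum (f := fun a : S => d a + t a) (fun _ _ => Nat.zero_le _)
      (Finset.mem_univ a)).trans (by omega)
  obtain ⟨c, hc, hb⟩ := hgen n (by omega) (fun a ha => by have := hle ⟨a, ha⟩; simp at this; omega)
    b b.2
  have key : ∀ (p : ℕ) (hp : i + p = l) (a : S) (q : ℕ) (hq : d a + q = p) (z : R) (hz : z ∈ 𝒜 q)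
      (hm : (a : R) * z ∈ 𝒜 p), t a ≤ q → N.act hp x ⟨(a : R) * z, hm⟩ = 0 := by
    intro p hp a q hq z hz hm hq'
    subst hq
    rw [← ht a q hq' ⟨z, hz⟩ l (by push_cast at hp; omega)]
    exact (N.act_mul rfl _ hp x ⟨(a : R), (hS a a.2).2⟩ ⟨z, hz⟩).symm
  have hmem : ∀ a : S, (a : R) * c a ∈ 𝒜 n := fun a => by
    have h2 := SetLike.GradedMul.mul_mem (A := 𝒜) (hS a a.2).2 (hc a a.2)
    rwa [Nat.add_sub_cancel' (by have := hle a; omega)] at h2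
  have hb' : b = ∑ a : S, (⟨(a : R) * c a, hmem a⟩ : 𝒜 n) := by
    apply Subtype.ext
    rw [hb, AddSubmonoidClass.coe_finsetSum, ← Finset.sum_coe_sort]
  rw [hb', map_sum]
  refine Finset.sum_eq_zero fun a _ => key n h a (n - d a) ?_ _ (hc a a.2) _ ?_
  · have := hle a; omega
  · have := hle a; omega

lemma exists_of_exact {S : ShortComplex (GrMod 𝒜)} (hS : S.Exact) (i : ℤ) (x : S.X₂.obj i)
    (hx : S.g.app i x = 0) : ∃ y, S.f.app i y = x := by
  have h := (ShortComplex.exact_iff_kernel_ι_comp_cokernel_π_zero S).1 hS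
  have h2 : kerι S.g ≫ cokerπ S.f = 0 := by
    have e1 : kerι S.g = kernel.lift S.g (kerι S.g) (kerι_comp _) ≫ kernel.ι S.g := by simp
    have e2 : cokerπ S.f = cokernel.π S.f ≫ cokernel.desc S.f (cokerπ S.f) (comp_cokerπ _) := by
      simp
    rw [e1, e2, Category.assoc, reassoc_of% h, zero_comp, comp_zero]
  exact (cokerπ_eq_zero_iff S.f i x).1 (congr_app h2 i ⟨x, hx⟩)

/-- Over a right Noetherian graded algebra the torsion modules form a Serre subcategory. -/
instance [IsNoetherianRing Rᵐᵒᵖ] : (torsion 𝒜).IsSerreClass where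
  exists_zero := ⟨0, isZero_zero _, fun i x => ⟨0, fun j _ a l h => by
    have hz : 𝟙 (0 : GrMod 𝒜) = 0 := (isZero_zero _).eq_of_src _ _
    have hx : x = 0 := congr_app hz i x
    simp [hx]⟩⟩
  prop_of_mono f _ := torsion_of_injective f (injective_of_mono f)
  prop_of_epi f _ := torsion_of_surjective f (surjective_of_epi f)
  prop_X₂_of_shortExact {S} hS h₁ h₃ :=
    torsion_of_extension S.f S.g (exists_of_exact hS.exact) h₁ h₃

lemma isoModSerre_iff_ker_coker [IsNoetherianRing Rᵐᵒᵖ] (f : M ⟶ N) :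
    (torsion 𝒜).isoModSerre f ↔ torsion 𝒜 (ker f) ∧ torsion 𝒜 (coker f) := by
  have e1 : kernel f ≅ ker f := (limit.isLimit _).conePointUniqueUpToIso (kerIsLimit f)
  have e2 : cokernel f ≅ coker f :=
    (colimit.isColimit _).coconePointUniqueUpToIso (cokerIsColimit f)
  exact and_congr ((torsion 𝒜).prop_iff_of_iso e1) ((torsion 𝒜).prop_iff_of_iso e2)

lemma torsion_shift {M : GrMod 𝒜} (n : ℤ) (hM : torsion 𝒜 M) :
    torsion 𝒜 ((shift 𝒜 n).obj M) := fun i x => by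
  obtain ⟨s, hs⟩ := hM (n + i) x
  exact ⟨s, fun j hj a l h => hs j hj a (n + l) (by rw [add_assoc, h])⟩

end GrMod

/-! ### The noncommutative projective scheme and its cohomology -/

variable (𝒜) [IsNoetherianRing Rᵐᵒᵖ]

/-- `QGr(R) = Gr(R) / Tor(R)`: the quotient of `Gr(R)` by the Serre subcategory of torsion
modules, that is, the localization at the morphisms with torsion kernel and cokernel. -/
abbrev QGr : Type (max w (u + 1)) := (GrMod.torsion 𝒜).isoModSerre.Localization

/-- The quotient functor `Gr(R) ⥤ QGr(R)`. -/
abbrev quotientFunctor : GrMod 𝒜 ⥤ QGr 𝒜 := (GrMod.torsion 𝒜).isoModSerre.Q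

noncomputable instance : Abelian (QGr 𝒜) :=
  ObjectProperty.SerreClassLocalization.abelian (quotientFunctor 𝒜) (GrMod.torsion 𝒜)

/-- The `Ext` groups of `QGr(R)` exist (in some large enough universe). -/
instance : HasExt.{max w (u + 1)} (QGr 𝒜) := HasExt.standard _

lemma shift_inverts (n : ℤ) : (GrMod.torsion 𝒜).isoModSerre.IsInvertedBy
    (GrMod.shift 𝒜 n ⋙ quotientFunctor 𝒜) := fun M N f hf => by
  rw [GrMod.isoModSerre_iff_ker_coker] at hf
  refine Localization.inverts (quotientFunctor 𝒜) (GrMod.torsion 𝒜).isoModSerre _ ?_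
  rw [GrMod.isoModSerre_iff_ker_coker]
  exact ⟨GrMod.torsion_shift n hf.1, GrMod.torsion_shift n hf.2⟩

/-- The shift `𝓜 ↦ 𝓜[n]` of `QGr(R)` induced by the shift of graded modules. -/
noncomputable def qShift (n : ℤ) : QGr 𝒜 ⥤ QGr 𝒜 :=
  Localization.lift (GrMod.shift 𝒜 n ⋙ quotientFunctor 𝒜) (shift_inverts 𝒜 n) (quotientFunctor 𝒜)

/-- The structure sheaf of `Proj R`: the image of the graded right module `R` in `QGr(R)`.
The projective scheme `Proj R` is the triple formed by `QGr(R)`, this object and the shift. -/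
noncomputable def structureSheaf : QGr 𝒜 := (quotientFunctor 𝒜).obj (GrMod.self 𝒜)

/-- The cohomology `H^i(𝓜) = Ext^i(𝓡, 𝓜)`, computed in `QGr(R)`. -/
abbrev cohomology (i : ℕ) (M : QGr 𝒜) : Type (max w (u + 1)) :=
  Abelian.Ext.{max w (u + 1)} (structureSheaf 𝒜) M i

/-- The graded cohomology `⨁ n, H^i(𝓜[n])`, `n` running through the integers. -/
abbrev gradedCohomology (i : ℕ) (M : QGr 𝒜) : Type (max w (u + 1)) :=
  ⨁ n : ℤ, cohomology 𝒜 i ((qShift 𝒜 n).obj M)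

/-- The cohomological dimension of `Proj R`: the supremum of all `i` such that `H^i(𝓜) ≠ 0` for
some object `𝓜` of `qgr(R)`, the category of Noetherian objects of `QGr(R)`.  It is `⊤ = ∞` if
these `i` are unbounded, and `⊥ = -∞` if there are none. -/
noncomputable def cohomologicalDimension : WithBot ℕ∞ :=
  sSup {c : WithBot ℕ∞ | ∃ i : ℕ, c = i ∧ ∃ M : QGr 𝒜, IsNoetherianObject M ∧ Nontrivial (cohomology 𝒜 i M)}

end GradedModules

/-- The left global dimension of a ring: the supremum of the projective dimensions of its left
modules. -/
noncomputable def leftGlobalDimension (R : Type u) [Ring R] : WithBot ℕ∞ :=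
  ⨆ M : ModuleCat.{u} R, projectiveDimension M

end NCProj

/-! Part 1. A Noetherian object of `QGr 𝒜` is a quotient of the image of a finite free graded module
(`exists_epi_free`), with Noetherian kernel. If H^{i+1} vanishes on qgr, the long exact sequence
shows that H^i of the free object surjects onto H^i of the quotient; so H^i(M) ≠ 0 forces H^i(R[n])
≠ 0 for some n (`exists_nontrivial_cohomology_qShift`). Finiteness of cd provides a largest i at
which to apply this.

Part 2 combines two facts.

(a) For Noetherian N, every class in Ext^i(πN, πM) in the quotient category becomes, once restricted
to a truncation N_{≥n}, the image of a class in Ext^i(N_{≥n}, M) over graded modules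
(`GrMod.IsNoeth.exists_ext`). The restriction loses nothing, since N_{≥n} → N is an isomorphism
modulo torsion. Degree 0 is calculus of fractions. A class of positive degree is killed by some
epimorphism, which can be replaced by a finite free cover of a truncation; dimension shifting then
lowers i.

(b) A Noetherian graded right module has projective dimension at most the left global dimension d
(`NoethMod.hasProjectiveDimensionLE`). The passage from left to right is through Tor: a free
resolution stays exact beyond position d after tensoring with any left module. Tensoring is
expressed by the matrices of the resolution acting on vectors with entries in the left module.
Exactness on one well-chosen left module gives a generalized inverse of a differential, whose degree
0 part makes the d-th syzygy projective.

By (b), R/R_{≥n} has projective dimension at most d, so for d ≥ 1 the module R_{≥n} has projective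
dimension at most d - 1, and (a) kills H^i for i ≥ d. For d = 0 the projection R → R/R_{≥1} splits,
which forces R_{≥1} = 0 and πR = 0. -/

namespace CategoryTheory.Abelian

-- Ext groups in abelian categories: effaceability and exact functors

universe v' u' w'

variable {C : Type u'} [Category.{v'} C] [Abelian C]

open HomologicalComplex in
/-- A resolution `K → X` concentrated in degrees `≤ 0` starts with an epimorphism `K⁰ → X`. -/
lemma exists_epi_comp_eq_single_map {X : C} {K : CochainComplex C ℤ}
    (π : K ⟶ (single C (ComplexShape.up ℤ) 0).obj X) [K.IsStrictlyLE 0] [QuasiIsoAt π 0] :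
    ∃ (p : K.X 0 ⟶ X) (_ : Epi p) (σ : (single C (ComplexShape.up ℤ) 0).obj (K.X 0) ⟶ K),
      σ ≫ π = (single C (ComplexShape.up ℤ) 0).map p := by
  have hz : ∀ k, (ComplexShape.up ℤ).Rel 0 k → K.d 0 k = 0 := fun k hk =>
    (K.isZero_of_isStrictlyLE 0 k (by rw [← show 0 + 1 = k from hk]; simp)).eq_of_tgt _ _
  -- As K¹ = 0, all of K⁰ consists of cycles; `α` is K⁰ → H⁰(K) ≅ X, epi because the projection to
  -- homology is.
  let e := K.iCyclesIso 0 (0 + 1) (by simp) (hz _ (by simp))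
  let α := e.inv ≫ K.homologyπ 0 ≫ homologyMap π 0 ≫ (singleObjHomologySelfIso _ _ _).hom
  have h : π.f 0 = α ≫ (singleObjXSelf (ComplexShape.up ℤ) 0 X).inv := by
    rw [← cancel_epi e.hom]
    have he : e.hom = K.iCycles 0 := rfl
    dsimp only [α]
    rw [Category.assoc, Category.assoc, Category.assoc, Iso.hom_inv_id_assoc, he,
      homologyπ_naturality_assoc, homologyπ_singleObjHomologySelfIso_hom_assoc,
      ← singleObjCyclesSelfIso_inv_iCycles, Iso.hom_inv_id_assoc, ← cyclesMap_i]
  -- The inclusion of K⁰ into K is a chain map since the differential leaving degree 0 is zero.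
  refine ⟨α, inferInstance, mkHomFromSingle (𝟙 _) fun k hk => by rw [hz k hk, comp_zero], ?_⟩
  apply from_single_hom_ext
  rw [comp_f, mkHomFromSingle_f, Category.assoc, h, single_map_f_self, Category.id_comp]

/-- Classes in `Ext` of positive degree are killed by epimorphisms. -/
lemma Ext.exists_epi_comp_eq_zero [HasExt.{w'} C] {X Y : C} {n : ℕ} (e : Ext X Y (n + 1)) :
    ∃ (X' : C) (p : X' ⟶ X) (_ : Epi p), (Ext.mk₀ p).comp e (zero_add _) = 0 := by
  let := HasDerivedCategory.standard C
  -- Replaces the (n+1)-fold shift of Y by the complex with Y in degree -(n+1), so that `e` becomes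
  -- a morphism between images of complexes and can be written as a roof.
  let E := ((DerivedCategory.singleFunctors C).shiftIso ((n + 1 : ℕ) : ℤ) (-((n + 1 : ℕ) : ℤ)) 0 (by lia)).hom.app Y
  have key : ∀ (φ : DerivedCategory.Q.obj ((CochainComplex.singleFunctor C 0).obj X) ⟶
      DerivedCategory.Q.obj ((CochainComplex.singleFunctor C (-((n + 1 : ℕ) : ℤ))).obj Y)),
      ∃ (X' : C) (p : X' ⟶ X) (_ : Epi p),
        DerivedCategory.Q.map ((CochainComplex.singleFunctor C 0).map p) ≫ φ = 0 := by
    intro φ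
    obtain ⟨K, _, π, h, g, rfl⟩ := DerivedCategory.right_fac_of_isStrictlyLE φ 0
    rw [DerivedCategory.isIso_Q_map_iff_quasiIso] at h
    obtain ⟨p, hp, σ, hσ⟩ : ∃ (p : K.X 0 ⟶ X) (_ : Epi p)
        (σ : (CochainComplex.singleFunctor C 0).obj (K.X 0) ⟶ K),
        σ ≫ π = (CochainComplex.singleFunctor C 0).map p :=
      @exists_epi_comp_eq_single_map _ _ _ X K π _ (h.quasiIsoAt 0)
    -- Positivity of the degree enters here: the source sits in degree 0, where the target vanishes.
    have h₂ : σ ≫ g = 0 := by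
      apply HomologicalComplex.from_single_hom_ext
      apply (CochainComplex.isZero_of_isStrictlyLE _ (-((n + 1 : ℕ) : ℤ)) 0 (by lia)).eq_of_tgt
    refine ⟨_, p, hp, ?_⟩
    rw [← hσ, Functor.map_comp, Category.assoc, IsIso.hom_inv_id_assoc, ← Functor.map_comp, h₂,
      Functor.map_zero]
  obtain ⟨X', p, hp, h⟩ := key (e.hom ≫ E)
  refine ⟨X', p, hp, ?_⟩
  apply Ext.ext
  rw [Ext.comp_hom, Ext.mk₀_hom, ShiftedHom.mk₀_comp, Ext.zero_hom, ← cancel_mono E, Limits.zero_comp,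
    Category.assoc]
  exact h

/-- The image under an exact functor of the pullback of an extension class along a morphism of
short exact sequences. -/
lemma Ext.mapExactFunctor_extClass_comp {D : Type*} [Category* D] [Abelian D] [HasExt.{w'} C]
    [HasExt.{w'} D] (F : C ⥤ D) [F.Additive] [PreservesFiniteLimits F] [PreservesFiniteColimits F]
    {S' S : ShortComplex C} (φ : S' ⟶ S) (hS' : S'.ShortExact) (hS : S.ShortExact) {Y : C} {n m : ℕ}
    (h : 1 + n = m) (e' : Ext S'.X₁ Y n) (e : Ext (F.obj S.X₁) (F.obj Y) n)
    (he : e'.mapExactFunctor F = (Ext.mk₀ (F.map φ.τ₁)).comp e (zero_add n)) :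
    (hS'.extClass.comp e' h).mapExactFunctor F =
      (Ext.mk₀ (F.map φ.τ₃)).comp ((hS.map_of_exact F).extClass.comp e h) (zero_add m) := by
  have hφ := ShortComplex.ShortExact.extClass_naturality (hS'.map_of_exact F) (hS.map_of_exact F)
    (F.mapShortComplex.map φ)
  rw [Ext.mapExactFunctor_comp, he, Ext.mapExactFunctor_extClass]
  refine (Ext.comp_assoc (hS'.map_of_exact F).extClass _ e (add_zero 1) (zero_add n)
    (by lia)).symm.trans ?_
  refine (congrArg (fun z => Ext.comp z e h) hφ).trans ?_
  exact Ext.comp_assoc _ (hS.map_of_exact F).extClass e (zero_add 1) h (by lia)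

end CategoryTheory.Abelian

namespace NCProj

section

variable {k : Type w} [Field k] {R : Type u} [Ring R] [Algebra k R]
variable {𝒜 : ℕ → Submodule k R}

namespace GrMod

lemma eq_zero_of_mem_intPiece {i : ℤ} (hi : i < 0) {x : R} (hx : x ∈ intPiece 𝒜 i) : x = 0 := by
  cases i with
  | ofNat n => simp at hi; omega
  | negSucc n => exact hx

variable [GradedAlgebra 𝒜]

/-! ### Homogeneous components -/

variable (𝒜) in
/-- The homogeneous component of integer degree `i`. -/
def comp : ℤ → R →+ R
  | Int.ofNat n => GradedRing.proj 𝒜 n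
  | Int.negSucc _ => 0

lemma comp_natCast (n : ℕ) (x : R) : comp 𝒜 n x = DirectSum.decompose 𝒜 x n := rfl

lemma comp_of_neg {i : ℤ} (hi : i < 0) (x : R) : comp 𝒜 i x = 0 := by
  cases i with
  | ofNat n => simp at hi; omega
  | negSucc n => rfl

lemma one_mem_intPiece {i : ℤ} (hi : i = 0) : (1 : R) ∈ intPiece 𝒜 i := by
  subst hi
  exact SetLike.GradedOne.one_mem (A := 𝒜)

lemma comp_mem (i : ℤ) (x : R) : comp 𝒜 i x ∈ intPiece 𝒜 i := by
  cases i with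
  | ofNat n => exact SetLike.coe_mem (DirectSum.decompose 𝒜 x n)
  | negSucc n => rfl

lemma comp_of_mem {i : ℤ} {x : R} (hx : x ∈ intPiece 𝒜 i) : comp 𝒜 i x = x := by
  cases i with
  | ofNat n => exact DirectSum.decompose_of_mem_same 𝒜 hx
  | negSucc n => exact (show x = 0 from hx).symm

lemma comp_of_mem_ne {i j : ℤ} {x : R} (hx : x ∈ intPiece 𝒜 i) (h : i ≠ j) : comp 𝒜 j x = 0 := by
  cases i with
  | ofNat n =>
    cases j with
    | ofNat m => exact DirectSum.decompose_of_mem_ne 𝒜 hx (by rintro rfl; exact h rfl)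
    | negSucc m => rfl
  | negSucc n => rw [show x = 0 from hx, map_zero]

/-- Integer degrees remove any comparison between `j` and `l`: when `l < j`, both sides vanish
because the component of negative degree `i` is zero. -/
lemma comp_mul_right {i j l : ℤ} (h : i + j = l) (x : R) {a : R} (ha : a ∈ intPiece 𝒜 j) :
    comp 𝒜 l (x * a) = comp 𝒜 i x * a := by
  cases j with
  | negSucc n => simp [show a = 0 from ha]
  | ofNat j =>
    cases l with
    | negSucc l =>
      rw [comp_of_neg (by simp at h ⊢), comp_of_neg (i := i) (by simp at h ⊢; omega), zero_mul]
    | ofNat l =>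
      by_cases hjl : j ≤ l
      · obtain rfl : i = (l - j : ℕ) := by simp at h; omega
        exact DirectSum.coe_decompose_mul_of_right_mem_of_le 𝒜 ha hjl
      · rw [comp_of_neg (i := i) (by simp at h ⊢; omega), zero_mul]
        exact DirectSum.coe_decompose_mul_of_right_mem_of_not_le 𝒜 ha hjl

lemma comp_mul_left {i j l : ℤ} (h : i + j = l) {a : R} (ha : a ∈ intPiece 𝒜 i) (x : R) :
    comp 𝒜 l (a * x) = a * comp 𝒜 j x := by
  cases i with
  | negSucc n => simp [show a = 0 from ha]
  | ofNat i =>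
    cases l with
    | negSucc l =>
      rw [comp_of_neg (by simp at h ⊢), comp_of_neg (i := j) (by simp at h ⊢; omega), mul_zero]
    | ofNat l =>
      by_cases hil : i ≤ l
      · obtain rfl : j = (l - i : ℕ) := by simp at h; omega
        exact DirectSum.coe_decompose_mul_of_left_mem_of_le 𝒜 ha hil
      · rw [comp_of_neg (i := j) (by simp at h ⊢; omega), mul_zero]
        exact DirectSum.coe_decompose_mul_of_left_mem_of_not_le 𝒜 ha hil

-- Allowing every larger set lets finitely many coordinates of a vector share one index set, even
-- though their degrees are offset by different `d`.
variable (𝒜) in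
lemma exists_sum_comp (d : ℤ) (x : R) :
    ∃ s : Finset ℤ, ∀ s' : Finset ℤ, s ⊆ s' → ∑ l ∈ s', comp 𝒜 (l - d) x = x := by
  classical
  let f : ℕ ↪ ℤ := ⟨fun n => n + d, fun a b h => by simpa using h⟩
  have hf : ∀ n, f n = n + d := fun _ => rfl
  refine ⟨(DirectSum.decompose 𝒜 x).support.map f, fun s' hs' => ?_⟩
  rw [← Finset.sum_subset hs', Finset.sum_map]
  · simp only [hf, add_sub_cancel_right, comp_natCast]
    exact DirectSum.sum_support_decompose 𝒜 x
  · intro l _ hl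
    by_cases h : l - d < 0
    · exact comp_of_neg h x
    · obtain ⟨n, hn⟩ := Int.eq_ofNat_of_zero_le (not_lt.1 h)
      rw [hn, comp_natCast]
      by_contra hne
      refine hl (Finset.mem_map.2 ⟨n, ?_, ?_⟩)
      · simpa using hne
      · rw [hf]; omega

/-! ### The total action -/

variable (M : GrMod 𝒜) {N : GrMod 𝒜}

/-- The action `M_i × R → M_l` through the homogeneous component of degree `l - i`. -/
def sm (i l : ℤ) : M.obj i →+ R →+ M.obj l :=
  if h : i ≤ l then
    { toFun := fun m => (M.act (j := (l - i).toNat) (by omega) m).comp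
        { toFun := fun a => DirectSum.decompose 𝒜 a (l - i).toNat
          map_zero' := by simp
          map_add' := fun _ _ => by simp }
      map_zero' := by ext; simp
      map_add' := fun _ _ => by ext; simp }
  else 0

variable {M}

lemma sm_of_mem {i l : ℤ} {j : ℕ} (h : i + j = l) (m : M.obj i) (a : 𝒜 j) :
    M.sm i l m a = M.act h m a := by
  have hil : i ≤ l := by omega
  have : ∀ (j' : ℕ) (h' : i + j' = l), j' = j →
      M.act h' m (DirectSum.decompose 𝒜 (a : R) j') = M.act h m a := by
    rintro j' h' rfl
    simp
  rw [sm, dif_pos hil]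
  exact this _ _ (by omega)

lemma sm_of_lt {i l : ℤ} (h : l < i) (m : M.obj i) (a : R) : M.sm i l m a = 0 := by
  rw [sm, dif_neg (by omega)]
  rfl

lemma sm_comp (i l : ℤ) (m : M.obj i) (a : R) : M.sm i l m a = M.sm i l m (comp 𝒜 (l - i) a) := by
  by_cases h : i ≤ l
  · rw [sm, dif_pos h]
    obtain ⟨n, hn⟩ := Int.eq_ofNat_of_zero_le (sub_nonneg.2 h)
    obtain rfl : l = n + i := by omega
    have : ∀ (n' : ℕ) (h' : i + n' = n + i), n' = n → M.act h' m (DirectSum.decompose 𝒜 a n') =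
        M.act h' m (DirectSum.decompose 𝒜 (comp 𝒜 (n + i - i) a) n') := by
      rintro n' h' rfl
      rw [add_sub_cancel_right, comp_natCast]
      simp
    exact this _ _ (by omega)
  · rw [sm_of_lt (by omega), sm_of_lt (by omega)]

@[simp]
lemma map_sm (f : M ⟶ N) (i l : ℤ) (m : M.obj i) (a : R) :
    f.app l (M.sm i l m a) = N.sm i l (f.app i m) a := by
  by_cases h : i ≤ l
  · rw [sm, sm, dif_pos h, dif_pos h]
    exact f.map_act _ _ _
  · rw [sm_of_lt (by omega), sm_of_lt (by omega), map_zero]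

@[simp]
lemma sm_one (i : ℤ) (m : M.obj i) : M.sm i i m 1 = m :=
  (sm_of_mem (by simp) m ⟨1, SetLike.GradedOne.one_mem (A := 𝒜)⟩).trans (M.act_one _ m)

lemma act_sm {i l n : ℤ} {j : ℕ} (h : l + j = n) (m : M.obj i) {a : R}
    (ha : a ∈ intPiece 𝒜 (l - i)) (b : 𝒜 j) :
    M.act h (M.sm i l m a) b = M.sm i n m (a * b) := by
  by_cases hil : i ≤ l
  · obtain ⟨j', hj⟩ := Int.eq_ofNat_of_zero_le (sub_nonneg.2 hil)
    rw [hj] at ha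
    have h₁ := sm_of_mem (l := l) (by omega) m (⟨a, ha⟩ : 𝒜 j')
    have h₂ := sm_of_mem (l := n) (j := j' + j) (by omega) m
      ⟨a * b, SetLike.GradedMul.mul_mem (A := 𝒜) ha b.2⟩
    refine (congrArg (fun z => M.act h z b) h₁).trans (Eq.trans ?_ h₂.symm)
    exact M.act_mul _ _ _ m ⟨a, ha⟩ b
  · rw [eq_zero_of_mem_intPiece (by omega) ha]
    simp

/-! ### Free modules -/

variable (𝒜) in
/-- The free graded module with one generator in each of the degrees `d p`. -/
def free {ι : Type} (d : ι → ℤ) : GrMod 𝒜 where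
  obj l := (Submodule.pi Set.univ fun p => intPiece 𝒜 (l - d p)).toAddSubgroup
  act {i j l} h :=
    { toFun := fun v =>
        { toFun := fun a => ⟨fun p => v.1 p * a, fun p hp =>
            mul_mem_intPiece (by omega) (v.2 p hp) a.2⟩
          map_zero' := by ext; simp
          map_add' := fun _ _ => by ext; simp [mul_add] }
      map_zero' := by ext; simp
      map_add' := fun _ _ => by ext; simp [add_mul] }
  act_one _ v := Subtype.ext (funext fun p => mul_one _)
  act_mul _ _ _ v a b := Subtype.ext (funext fun p => mul_assoc _ _ _)

section Free

variable {ι : Type} {d : ι → ℤ}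

lemma free_mem {l : ℤ} (v : (free 𝒜 d).obj l) (p : ι) : v.1 p ∈ intPiece 𝒜 (l - d p) :=
  v.2 p trivial

/-- Elements of a free module from their coordinates. -/
def freeMk (l : ℤ) (v : ι → R) (hv : ∀ p, v p ∈ intPiece 𝒜 (l - d p)) : (free 𝒜 d).obj l :=
  ⟨v, fun p _ => hv p⟩

lemma free_ext {l : ℤ} {v v' : (free 𝒜 d).obj l} (h : ∀ p, v.1 p = v'.1 p) : v = v' :=
  Subtype.ext (funext h)

lemma free_sm {i l : ℤ} (v : (free 𝒜 d).obj i) (a : R) (p : ι) :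
    ((free 𝒜 d).sm i l v a).1 p = v.1 p * comp 𝒜 (l - i) a := by
  by_cases h : i ≤ l
  · obtain ⟨n, hn⟩ := Int.eq_ofNat_of_zero_le (sub_nonneg.2 h)
    rw [sm_comp]
    have hm := comp_mem (𝒜 := 𝒜) (l - i) a
    rw [hn] at hm ⊢
    have := sm_of_mem (l := l) (by omega) v (⟨_, hm⟩ : 𝒜 n)
    exact congrArg (fun z : (free 𝒜 d).obj l => z.1 p) this
  · rw [sm_of_lt (by omega), comp_of_neg (by omega), mul_zero]
    rfl

/-- The generators of a free module. -/
def freeBasis [DecidableEq ι] (p : ι) : (free 𝒜 d).obj (d p) :=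
  freeMk (d p) (Pi.single p 1) fun q => by
    by_cases h : q = p
    · subst h
      simpa using one_mem_intPiece (𝒜 := 𝒜) (sub_self (d q))
    · simp [h]

variable [Fintype ι]

/-- The morphism from a free module with given values on the generators. -/
def freeLift (m : ∀ p, M.obj (d p)) : free 𝒜 d ⟶ M where
  app l := ∑ p, (M.sm (d p) l (m p)).comp
    ((Pi.evalAddMonoidHom (fun _ : ι => R) p).comp (AddSubgroup.subtype _))
  map_act {i j l} h v a := by
    simp only [AddMonoidHom.finsetSum_apply, map_sum]
    exact Finset.sum_congr rfl fun p _ => (act_sm h (m p) (free_mem v p) a).symm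

lemma freeLift_app (m : ∀ p, M.obj (d p)) (l : ℤ) (v : (free 𝒜 d).obj l) :
    (freeLift m).app l v = ∑ p, M.sm (d p) l (m p) (v.1 p) := by
  simp only [freeLift, AddMonoidHom.finsetSum_apply]
  rfl

@[simp]
lemma freeLift_basis [DecidableEq ι] (m : ∀ p, M.obj (d p)) (p : ι) :
    (freeLift m).app (d p) (freeBasis p) = m p := by
  rw [freeLift_app, Finset.sum_eq_single p]
  · simp [freeBasis, freeMk]
  · intro q _ hq
    simp [freeBasis, freeMk, hq]
  · simp

lemma free_eq_sum [DecidableEq ι] {l : ℤ} (v : (free 𝒜 d).obj l) :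
    v = ∑ p, (free 𝒜 d).sm (d p) l (freeBasis p) (v.1 p) := by
  refine Subtype.ext ?_
  refine Eq.trans ?_ (map_sum (Submodule.pi Set.univ fun p => intPiece 𝒜 (l - d p)).toAddSubgroup.subtype _ _).symm
  funext q
  rw [Finset.sum_apply, Finset.sum_eq_single q]
  · refine Eq.trans ?_ (free_sm _ _ _).symm
    simp [freeBasis, freeMk, comp_of_mem (free_mem v q)]
  · intro p _ hp
    refine (free_sm _ _ _).trans ?_
    simp [freeBasis, freeMk, hp.symm]
  · simp

lemma free_hom_apply [DecidableEq ι] (f : free 𝒜 d ⟶ M) {l : ℤ} (v : (free 𝒜 d).obj l) :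
    f.app l v = ∑ p, M.sm (d p) l (f.app (d p) (freeBasis p)) (v.1 p) := by
  conv_lhs => rw [free_eq_sum v, map_sum]
  simp

lemma free_hom_ext [DecidableEq ι] {f g : free 𝒜 d ⟶ M}
    (h : ∀ p, f.app (d p) (freeBasis p) = g.app (d p) (freeBasis p)) : f = g := by
  ext l v
  rw [free_hom_apply f, free_hom_apply g]
  simp [h]

end Free

lemma mono_of_injective (f : M ⟶ N) (h : ∀ i, Function.Injective (f.app i)) : Mono f where
  right_cancellation a b hab := by
    ext i x
    exact h i (congr_app hab i x)

lemma epi_of_surjective (f : M ⟶ N) (h : ∀ i, Function.Surjective (f.app i)) : Epi f where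
  left_cancellation a b hab := by
    ext i x
    obtain ⟨x, rfl⟩ := h i x
    exact congr_app hab i x

instance {ι : Type} [Fintype ι] (d : ι → ℤ) : Projective (free 𝒜 d) where
  factors {E X} f e _ := by
    classical
    have hs := surjective_of_epi e
    refine ⟨freeLift fun p => (hs _ (f.app (d p) (freeBasis p))).choose, free_hom_ext fun p => ?_⟩
    rw [comp_app, freeLift_basis]
    exact (hs _ (f.app (d p) (freeBasis p))).choose_spec

/-- The morphism from the free module on one generator of degree `i` given by `x : M_i`. -/
def el {i : ℤ} (x : M.obj i) : free 𝒜 (fun _ : Unit => i) ⟶ M := freeLift fun _ => x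

lemma el_app {i : ℤ} (x : M.obj i) (l : ℤ) (v : (free 𝒜 (fun _ : Unit => i)).obj l) :
    (el x).app l v = M.sm i l x (v.1 ()) := by
  simp [el, freeLift_app]

lemma el_comp {i : ℤ} (x : M.obj i) (f : M ⟶ N) : el x ≫ f = el (f.app i x) := by
  ext l v
  simp [el_app]

lemma el_add {i : ℤ} (x y : M.obj i) : el (x + y) = el x + el y := by
  ext l v
  simp [el_app]

lemma el_zero {i : ℤ} : el (0 : M.obj i) = 0 := by
  ext l v
  simp [el_app]

lemma el_neg {i : ℤ} (x : M.obj i) : el (-x) = - el x := by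
  ext l v
  simp [el_app]

end GrMod
end
end NCProj

/-! ### Graded submodules and truncations -/

namespace NCProj

section

variable {k : Type w} [Field k] {R : Type u} [Ring R] [Algebra k R]
variable {𝒜 : ℕ → Submodule k R} [GradedAlgebra 𝒜]

/-- Graded submodules of a graded module. -/
@[ext]
structure GSub (M : GrMod 𝒜) where
  carrier : ∀ i, AddSubgroup (M.obj i)
  act_mem : ∀ {i : ℤ} {j : ℕ} {l : ℤ} (h : i + j = l) (m : M.obj i) (a : 𝒜 j),
    m ∈ carrier i → M.act h m a ∈ carrier l

namespace GSub

open GrMod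

variable {M N L : GrMod 𝒜}

instance : PartialOrder (GSub M) := PartialOrder.lift carrier fun _ _ => GSub.ext

lemma le_def {S T : GSub M} : S ≤ T ↔ ∀ i x, x ∈ S.carrier i → x ∈ T.carrier i := Iff.rfl

/-- A graded submodule as a graded module. -/
def toMod (S : GSub M) : GrMod 𝒜 where
  obj i := S.carrier i
  act {i j l} h :=
    { toFun := fun m =>
        { toFun := fun a => ⟨M.act h m a, S.act_mem h m a m.2⟩
          map_zero' := by ext; simp
          map_add' := fun _ _ => by ext; simp }
      map_zero' := by ext; simp
      map_add' := fun _ _ => by ext; simp }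
  act_one h m := Subtype.ext (M.act_one h m)
  act_mul h₁ h₂ h₃ m a b := Subtype.ext (M.act_mul h₁ h₂ h₃ m a b)

/-- The inclusion of a graded submodule. -/
def ι (S : GSub M) : S.toMod ⟶ M where
  app i := (S.carrier i).subtype
  map_act _ _ _ := rfl

lemma ι_injective (S : GSub M) (i : ℤ) : Function.Injective (S.ι.app i) := Subtype.val_injective

instance (S : GSub M) : Mono S.ι := mono_of_injective _ S.ι_injective

lemma ι_app_mem (S : GSub M) {i : ℤ} (x : S.toMod.obj i) : S.ι.app i x ∈ S.carrier i := x.2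

/-- A morphism with values in a graded submodule, as a morphism to it. -/
def lift (S : GSub M) (f : N ⟶ M) (h : ∀ i x, f.app i x ∈ S.carrier i) : N ⟶ S.toMod where
  app i := (f.app i).codRestrict _ (h i)
  map_act h m a := Subtype.ext (f.map_act h m a)

/-- The range of a morphism. -/
def range (f : N ⟶ M) : GSub M where
  carrier i := (f.app i).range
  act_mem := by
    rintro i j l h _ a ⟨m, rfl⟩
    exact ⟨_, f.map_act h m a⟩

/-- The preimage of a graded submodule. -/
def comap (f : N ⟶ M) (S : GSub M) : GSub N where
  carrier i := (S.carrier i).comap (f.app i)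
  act_mem h m a hm := by
    have := S.act_mem h _ a hm
    rwa [← f.map_act] at this

/-- The image of a graded submodule. -/
def map (f : N ⟶ M) (S : GSub N) : GSub M where
  carrier i := (S.carrier i).map (f.app i)
  act_mem := by
    rintro i j l h _ a ⟨m, hm, rfl⟩
    exact ⟨_, S.act_mem h m a hm, f.map_act h m a⟩

variable (M) in
/-- The truncation `M_{≥ n}`. -/
def trunc (n : ℤ) : GSub M where
  carrier i := { carrier := {x | i < n → x = 0}
                 zero_mem' := fun _ => rfl
                 add_mem' := fun hx hy h => by rw [hx h, hy h, add_zero]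
                 neg_mem' := fun hx h => by rw [hx h, neg_zero] }
  act_mem h m a hm hl := by rw [hm (by omega), map_zero]; rfl

lemma mem_trunc_of_le {n i : ℤ} (h : n ≤ i) (x : M.obj i) : x ∈ (trunc M n).carrier i :=
  fun h' => by omega

end GSub

/-! ### Noetherian graded modules and finite generation -/

namespace GrMod

variable {M N L : GrMod 𝒜}

/-- Truncation on morphisms. -/
def truncMap (f : N ⟶ M) (n : ℤ) : (GSub.trunc N n).toMod ⟶ (GSub.trunc M n).toMod :=
  GSub.lift _ ((GSub.trunc N n).ι ≫ f) fun i x h => by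
    rw [comp_app, GSub.ι_app_mem (GSub.trunc N n) x h, map_zero]

@[simp]
lemma truncMap_ι (f : N ⟶ M) (n : ℤ) :
    truncMap f n ≫ (GSub.trunc M n).ι = (GSub.trunc N n).ι ≫ f := rfl

variable (M) in
/-- The inclusion `M_{≥ n'} ⟶ (M_{≥ n})_{≥ n'}` for `n ≤ n'`. -/
def truncTrunc {n n' : ℤ} (h : n ≤ n') :
    (GSub.trunc M n').toMod ⟶ (GSub.trunc (GSub.trunc M n).toMod n').toMod :=
  GSub.lift _ (GSub.lift _ (GSub.trunc M n').ι fun i x hi =>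
    GSub.ι_app_mem (GSub.trunc M n') x (by omega)) fun i x hi =>
      Subtype.ext (GSub.ι_app_mem (GSub.trunc M n') x hi)

lemma truncTrunc_ι {n n' : ℤ} (h : n ≤ n') :
    truncTrunc M h ≫ (GSub.trunc (GSub.trunc M n).toMod n').ι ≫ (GSub.trunc M n).ι =
      (GSub.trunc M n').ι := rfl

variable (M) in
/-- The inclusion `M_{≥ n'} ⟶ M_{≥ n}` for `n ≤ n'`. -/
def truncLE {n n' : ℤ} (h : n ≤ n') : (GSub.trunc M n').toMod ⟶ (GSub.trunc M n).toMod :=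
  GSub.lift _ (GSub.trunc M n').ι fun i x hi =>
    GSub.ι_app_mem (GSub.trunc M n') x (by omega)

lemma truncLE_ι {n n' : ℤ} (h : n ≤ n') :
    truncLE M h ≫ (GSub.trunc M n).ι = (GSub.trunc M n').ι := rfl

variable (M) in
/-- A graded module is Noetherian if its graded submodules satisfy the ascending chain condition. -/
def IsNoeth : Prop := WellFoundedGT (GSub M)

lemma IsNoeth.of_surjective (f : M ⟶ N) (hf : ∀ i, Function.Surjective (f.app i))
    (h : IsNoeth M) : IsNoeth N := by
  have : WellFoundedGT (GSub M) := h
  refine StrictMono.wellFoundedGT (f := GSub.comap f) (strictMono_of_le_iff_le fun S T => ?_)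
  refine ⟨fun h i x hx => h i hx, fun h i x hx => ?_⟩
  obtain ⟨x, rfl⟩ := hf i x
  exact h i hx

lemma IsNoeth.of_injective (f : N ⟶ M) (hf : ∀ i, Function.Injective (f.app i))
    (h : IsNoeth M) : IsNoeth N := by
  have : WellFoundedGT (GSub M) := h
  refine StrictMono.wellFoundedGT (f := GSub.map f) (strictMono_of_le_iff_le fun S T => ?_)
  refine ⟨fun h i => AddSubgroup.map_mono (h i), fun h i x hx => ?_⟩
  obtain ⟨y, hy, hxy⟩ := h i ⟨x, hx, rfl⟩
  exact hf i hxy ▸ hy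

lemma IsNoeth.sub (h : IsNoeth M) (S : GSub M) : IsNoeth S.toMod :=
  h.of_injective S.ι S.ι_injective

lemma IsNoeth.isNoeth_ker (h : IsNoeth M) (f : M ⟶ N) : IsNoeth (ker f) :=
  h.of_injective (kerι f) fun _ => Subtype.val_injective

lemma IsNoeth.isNoeth_coker (h : IsNoeth N) (f : M ⟶ N) : IsNoeth (coker f) :=
  h.of_surjective (cokerπ f) (cokerπ_surjective f)

section Free

variable {ι : Type} {d : ι → ℤ}

/-- The homogeneous components of a vector. -/
def compVec (d : ι → ℤ) (l : ℤ) : (ι → R) →+ (free 𝒜 d).obj l where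
  toFun w := freeMk l (fun p => comp 𝒜 (l - d p) (w p)) fun _ => comp_mem _ _
  map_zero' := free_ext fun _ => map_zero _
  map_add' _ _ := free_ext fun _ => map_add _ _ _

@[simp]
lemma compVec_apply (l : ℤ) (w : ι → R) (p : ι) :
    (compVec (𝒜 := 𝒜) d l w).1 p = comp 𝒜 (l - d p) (w p) := rfl

lemma compVec_of_mem {l : ℤ} (v : (free 𝒜 d).obj l) : compVec d l v.1 = v :=
  free_ext fun p => comp_of_mem (free_mem v p)

lemma compVec_of_ne {l l' : ℤ} (h : l ≠ l') (v : (free 𝒜 d).obj l) :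
    compVec (𝒜 := 𝒜) d l' v.1 = 0 :=
  free_ext fun p => comp_of_mem_ne (free_mem v p) (by omega)

variable (𝒜) in
lemma exists_sum_compVec [Finite ι] (d : ι → ℤ) (w : ι → R) :
    ∃ s : Finset ℤ, ∑ l ∈ s, (compVec (𝒜 := 𝒜) d l w).1 = w := by
  classical
  cases nonempty_fintype ι
  choose s hs using fun p => exists_sum_comp 𝒜 (d p) (w p)
  refine ⟨Finset.univ.biUnion s, funext fun p => ?_⟩
  rw [Finset.sum_apply]
  exact hs p _ (Finset.subset_biUnion_of_mem s (Finset.mem_univ p))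

/-- The submodule of `R^ι` generated by a graded submodule of a free module. -/
def ungrade (S : GSub (free 𝒜 d)) : Submodule Rᵐᵒᵖ (ι → R) where
  carrier := {w | ∀ l, compVec d l w ∈ S.carrier l}
  zero_mem' l := by rw [map_zero]; exact zero_mem _
  add_mem' hx hy l := by rw [map_add]; exact add_mem (hx l) (hy l)
  smul_mem' c w hw := by
    have key : ∀ r : R, ∀ l, compVec d l (fun p => w p * r) ∈ S.carrier l := fun r => by
      refine DirectSum.Decomposition.inductionOn 𝒜 ?_ ?_ ?_ r
      · intro l
        have : (fun p => w p * 0 : ι → R) = 0 := by ext; simp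
        rw [this, map_zero]
        exact zero_mem _
      -- For homogeneous `a` of degree j, the degree l part of w·a is the degree l - j part of w
      -- times a.
      · intro j a l
        have h := S.act_mem (i := l - j) (l := l) (by omega) _ a (hw (l - j))
        convert h using 1
        refine free_ext fun p => ?_
        refine comp_mul_right (𝒜 := 𝒜) (i := l - j - d p) (j := j) (by omega) (w p) a.2
      · intro a b ha hb l
        have : (fun p => w p * (a + b)) = (fun p => w p * a) + fun p => w p * b := by
          ext; simp [mul_add]
        rw [this, map_add]
        exact add_mem (ha l) (hb l)
    exact key c.unop

lemma coe_mem_ungrade {S : GSub (free 𝒜 d)} {l : ℤ} (v : (free 𝒜 d).obj l) :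
    v.1 ∈ ungrade S ↔ v ∈ S.carrier l := by
  refine ⟨fun h => compVec_of_mem v ▸ h l, fun h l' => ?_⟩
  by_cases hl : l = l'
  · subst hl
    rwa [compVec_of_mem]
  · rw [compVec_of_ne hl]
    exact zero_mem _

lemma isNoetherian_op [IsNoetherianRing Rᵐᵒᵖ] : IsNoetherian Rᵐᵒᵖ R :=
  isNoetherian_of_surjective
    ({ toFun := MulOpposite.unop, map_add' := fun _ _ => rfl, map_smul' := fun _ _ => rfl } :
      Rᵐᵒᵖ →ₗ[Rᵐᵒᵖ] R) (LinearMap.range_eq_top.2 MulOpposite.unop_surjective)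

/-- `ungrade` embeds the order of graded submodules into that of submodules of the ungraded module
R^ι, which satisfies the ascending chain condition as R is right Noetherian. -/
lemma isNoeth_free [IsNoetherianRing Rᵐᵒᵖ] [Finite ι] (d : ι → ℤ) : IsNoeth (free 𝒜 d) := by
  have : IsNoetherian Rᵐᵒᵖ R := isNoetherian_op
  have : WellFoundedGT (Submodule Rᵐᵒᵖ (ι → R)) := isNoetherian_iff'.1 inferInstance
  refine StrictMono.wellFoundedGT (f := ungrade) (strictMono_of_le_iff_le fun S T => ?_)
  refine ⟨fun h w hw l => h l (hw l), fun h l v hv => ?_⟩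
  exact (coe_mem_ungrade v).1 (h ((coe_mem_ungrade v).2 hv))

end Free

lemma freeLift_comp {ι ι' : Type} [Fintype ι] [Fintype ι'] [DecidableEq ι'] {d : ι' → ℤ}
    (m : ∀ p, M.obj (d p)) (e : ι → ι') :
    freeLift (d := fun p => d (e p)) (fun p => freeBasis (e p)) ≫ freeLift m =
      freeLift fun p => m (e p) := by
  classical
  refine free_hom_ext fun p => ?_
  rw [comp_app, freeLift_basis, freeLift_basis, freeLift_basis]

lemma freeLift_eta {ι : Type} [Fintype ι] [DecidableEq ι] {d : ι → ℤ} (f : free 𝒜 d ⟶ M) :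
    freeLift (fun p => f.app (d p) (freeBasis p)) = f :=
  free_hom_ext fun p => freeLift_basis _ p

/-- A morphism from a free module can be extended to one more generator sent to `x`. -/
lemma exists_extend {ι : Type} [Fintype ι] {d : ι → ℤ} (f : free 𝒜 d ⟶ M) {i : ℤ} (x : M.obj i) :
    ∃ (ι' : Type) (_ : Fintype ι') (d' : ι' → ℤ) (f' : free 𝒜 d' ⟶ M),
      (∃ g, g ≫ f' = f) ∧ ∃ g, g ≫ f' = el x := by
  classical
  let d' : Option ι → ℤ := fun p => p.elim i d
  let m : ∀ p : Option ι, M.obj (d' p) := fun p => match p with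
    | none => x
    | some p => f.app (d p) (freeBasis p)
  exact ⟨Option ι, inferInstance, d', freeLift m,
    ⟨_, (freeLift_comp m some).trans (freeLift_eta f)⟩, ⟨_, freeLift_comp m fun _ : Unit => none⟩⟩

@[simp]
lemma el_basis {i : ℤ} (x : M.obj i) : (el x).app i (freeBasis ()) = x :=
  freeLift_basis (d := fun _ : Unit => i) _ ()

/-- Noetherian graded modules are finitely generated. -/
lemma IsNoeth.exists_free (h : IsNoeth M) :
    ∃ (ι : Type) (_ : Fintype ι) (d : ι → ℤ) (f : free 𝒜 d ⟶ M), Epi f := by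
  classical
  have hw : WellFoundedGT (GSub M) := h
  let A : Set (GSub M) := {S | ∃ (ι : Type) (_ : Fintype ι) (d : ι → ℤ) (f : free 𝒜 d ⟶ M),
    S = GSub.range f}
  -- A maximal image of a finite free module; the zero map from the free module on no generators
  -- shows that there is one. Adding a generator sent to an arbitrary `x` cannot enlarge it, so it
  -- is everything.
  obtain ⟨S, ⟨ι, _, d, f, rfl⟩, hS⟩ := hw.wf.has_min A
    ⟨_, Empty, inferInstance, fun _ => 0, 0, rfl⟩
  refine ⟨ι, inferInstance, d, f, epi_of_surjective f fun i x => ?_⟩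
  obtain ⟨ι', _, d', f', ⟨g, hg⟩, ⟨g', hg'⟩⟩ := exists_extend f x
  have hle : GSub.range f ≤ GSub.range f' := by
    rintro l _ ⟨v, rfl⟩
    exact ⟨g.app l v, congr_app hg l v⟩
  have he := hle.eq_of_not_lt (hS _ ⟨_, inferInstance, _, _, rfl⟩)
  have hx : x ∈ (GSub.range f').carrier i := ⟨_, (congr_app hg' i (freeBasis ())).trans (el_basis x)⟩
  rw [← he] at hx
  exact hx

/-! ### Torsion -/

/-- A homogeneous element is torsion if it is killed by some `R_{≥ s}`. -/
def IsTorsionElt {i : ℤ} (x : M.obj i) : Prop :=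
  ∃ s : ℕ, ∀ (j : ℕ), s ≤ j → ∀ (a : 𝒜 j) (l : ℤ) (h : i + j = l), M.act h x a = 0

lemma IsTorsionElt.map (f : M ⟶ N) {i : ℤ} {x : M.obj i} (h : IsTorsionElt x) :
    IsTorsionElt (f.app i x) := by
  obtain ⟨s, hs⟩ := h
  exact ⟨s, fun j hj a l h => by rw [← f.map_act, hs j hj, map_zero]⟩

lemma IsTorsionElt.of_map (f : M ⟶ N) (hf : ∀ i, Function.Injective (f.app i)) {i : ℤ}
    {x : M.obj i} (h : IsTorsionElt (f.app i x)) : IsTorsionElt x := by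
  obtain ⟨s, hs⟩ := h
  exact ⟨s, fun j hj a l h => hf l (by rw [f.map_act, hs j hj, map_zero])⟩

lemma isTorsionElt_zero (i : ℤ) : IsTorsionElt (0 : M.obj i) := ⟨0, by simp⟩

/-- A Noetherian torsion module vanishes in large degrees. -/
lemma IsNoeth.exists_bound (h : IsNoeth M) (ht : torsion 𝒜 M) :
    ∃ n : ℤ, ∀ i, n ≤ i → ∀ x : M.obj i, x = 0 := by
  classical
  obtain ⟨ι, _, d, f, hf⟩ := h.exists_free
  choose s hs using fun p => ht (d p) (f.app (d p) (freeBasis p))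
  -- From degree n on, the coefficient of each generator has degree large enough to kill that
  -- generator.
  obtain ⟨n, hn⟩ := (Set.finite_range fun p => d p + s p).bddAbove
  refine ⟨n, fun i hi x => ?_⟩
  obtain ⟨v, rfl⟩ := surjective_of_epi f i x
  rw [free_hom_apply]
  refine Finset.sum_eq_zero fun p _ => ?_
  have hp : d p + s p ≤ n := hn ⟨p, rfl⟩
  obtain ⟨j, hj⟩ := Int.eq_ofNat_of_zero_le (show 0 ≤ i - d p by omega)
  have hm := free_mem v p
  rw [hj] at hm
  exact (sm_of_mem (by omega) _ (⟨_, hm⟩ : 𝒜 j)).trans (hs p j (by omega) _ _ _)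

lemma torsion_of_bound {n : ℤ} (h : ∀ i, n ≤ i → ∀ x : M.obj i, x = 0) : torsion 𝒜 M :=
  fun i _ => ⟨(n - i).toNat, fun _ _ _ l _ => h l (by omega) _⟩

/-- The cokernel is Noetherian and torsion, hence zero in large degrees. -/
lemma IsNoeth.exists_surjective (h : IsNoeth N) (f : M ⟶ N) (hf : torsion 𝒜 (GrMod.coker f)) :
    ∃ n : ℤ, ∀ i, n ≤ i → Function.Surjective (f.app i) := by
  obtain ⟨n, hn⟩ := (h.isNoeth_coker f).exists_bound hf
  exact ⟨n, fun i hi x => (cokerπ_eq_zero_iff f i x).1 (hn i hi _)⟩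

/-- The kernel is zero and the cokernel lives in degrees below `n`. Truncation is therefore
invisible in the quotient category. -/
lemma isoModSerre_trunc_ι [IsNoetherianRing Rᵐᵒᵖ] (n : ℤ) :
    (torsion 𝒜).isoModSerre (GSub.trunc M n).ι := by
  rw [isoModSerre_iff_ker_coker]
  refine ⟨fun i x => ?_, torsion_of_bound (n := n) fun i hi x => ?_⟩
  · have : x = 0 := Subtype.ext (GSub.ι_injective _ i (x.2.trans (map_zero _).symm))
    rw [this]
    exact isTorsionElt_zero i
  · obtain ⟨x, rfl⟩ := cokerπ_surjective _ i x
    rw [cokerπ_eq_zero_iff]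
    exact ⟨⟨x, GSub.mem_trunc_of_le hi x⟩, rfl⟩

end GrMod
end
end NCProj

namespace NCProj

section

variable {k : Type w} [Field k] {R : Type u} [Ring R] [Algebra k R]
variable {𝒜 : ℕ → Submodule k R} [GradedAlgebra 𝒜] [IsNoetherianRing Rᵐᵒᵖ]

open GrMod ObjectProperty.SerreClassLocalization

/-! ### The quotient functor -/

instance : (quotientFunctor 𝒜).Additive :=
  inferInstanceAs (GrMod.torsion 𝒜).isoModSerre.Q.Additive

instance : PreservesFiniteLimits (quotientFunctor 𝒜) :=
  preservesFiniteLimits (quotientFunctor 𝒜) (GrMod.torsion 𝒜)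

instance : PreservesFiniteColimits (quotientFunctor 𝒜) :=
  preservesFiniteColimits (quotientFunctor 𝒜) (GrMod.torsion 𝒜)

instance : (quotientFunctor 𝒜).EssSurj :=
  Localization.essSurj (quotientFunctor 𝒜) (GrMod.torsion 𝒜).isoModSerre

variable {M N L : GrMod 𝒜}

lemma isIso_quotientFunctor_map {f : M ⟶ N} (hf : (torsion 𝒜).isoModSerre f) :
    IsIso ((quotientFunctor 𝒜).map f) :=
  Localization.inverts (quotientFunctor 𝒜) (GrMod.torsion 𝒜).isoModSerre f hf

instance (n : ℤ) : IsIso ((quotientFunctor 𝒜).map (GSub.trunc M n).ι) :=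
  isIso_quotientFunctor_map (isoModSerre_trunc_ι n)

lemma torsion_coker_of_epi_map (f : M ⟶ N) [Epi ((quotientFunctor 𝒜).map f)] :
    torsion 𝒜 (coker f) := by
  have h := (epi_map_iff (quotientFunctor 𝒜) (torsion 𝒜) f).1 inferInstance
  exact ((torsion 𝒜).prop_iff_of_iso
    ((colimit.isColimit _).coconePointUniqueUpToIso (cokerIsColimit f))).1 h

/-- The functor kills `f` exactly when it kills the image of `f`, that is, when this image is a
torsion module. -/
lemma quotientFunctor_map_eq_zero_iff (f : M ⟶ N) :
    (quotientFunctor 𝒜).map f = 0 ↔ ∀ i x, IsTorsionElt (f.app i x) := by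
  rw [map_eq_zero_iff (quotientFunctor 𝒜) (torsion 𝒜)]
  have hfac : ∀ i x, (Abelian.image.ι f).app i ((Abelian.factorThruImage f).app i x) = f.app i x :=
    congr_app (Abelian.image.fac f)
  refine ⟨fun h i x => ?_, fun h i x => ?_⟩
  · rw [← hfac]
    exact IsTorsionElt.map (Abelian.image.ι f) (h i _)
  · obtain ⟨x, rfl⟩ := surjective_of_epi (Abelian.factorThruImage f) i x
    exact IsTorsionElt.of_map _ (injective_of_mono (Abelian.image.ι f)) (hfac i x ▸ h i x)

/-- The elements of `M` are jointly epimorphic in `QGr(R)`. -/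
lemma eq_zero_of_el_comp {Z : QGr 𝒜} (f : (quotientFunctor 𝒜).obj M ⟶ Z)
    (h : ∀ i (x : M.obj i), (quotientFunctor 𝒜).map (el x) ≫ f = 0) : f = 0 := by
  -- After replacing Z by the image of a graded module, `f` is a left fraction whose denominator
  -- becomes invertible; it remains to see that the numerator takes torsion values.
  obtain ⟨φ, hφ⟩ := Localization.exists_leftFraction (quotientFunctor 𝒜) (torsion 𝒜).isoModSerre
    (f ≫ ((quotientFunctor 𝒜).objObjPreimageIso Z).inv)
  have := isIso_quotientFunctor_map φ.hs
  have hf : f ≫ ((quotientFunctor 𝒜).objObjPreimageIso Z).inv ≫ (quotientFunctor 𝒜).map φ.s =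
      (quotientFunctor 𝒜).map φ.f := by
    rw [← Category.assoc, hφ, MorphismProperty.LeftFraction.map_comp_map_s]
  have h0 : (quotientFunctor 𝒜).map φ.f = 0 := by
    rw [quotientFunctor_map_eq_zero_iff]
    intro i x
    have hx : (quotientFunctor 𝒜).map (el x ≫ φ.f) = 0 := by
      rw [Functor.map_comp, ← hf, reassoc_of% (h i x), zero_comp]
    have := (quotientFunctor_map_eq_zero_iff _).1 hx i (freeBasis ())
    rwa [comp_app, el_basis] at this
  rw [h0, ← Category.assoc] at hf
  rwa [← cancel_mono (((quotientFunctor 𝒜).objObjPreimageIso Z).inv ≫ (quotientFunctor 𝒜).map φ.s),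
    zero_comp, ← Category.assoc]

/-! ### Noetherian objects of the quotient category -/

/-- The morphism given by `m * a` factors through the one given by `m`; this makes `GSub.killedBy`
stable under the action. -/
lemma el_act_comp_eq_zero {Z : QGr 𝒜} (c : (quotientFunctor 𝒜).obj M ⟶ Z) {i : ℤ} {j : ℕ} {l : ℤ}
    (h : i + j = l) (m : M.obj i) (a : 𝒜 j) (hm : (quotientFunctor 𝒜).map (el m) ≫ c = 0) :
    (quotientFunctor 𝒜).map (el (M.act h m a)) ≫ c = 0 := by
  have : el (M.act h m a) = el ((free 𝒜 fun _ : Unit => i).act h (freeBasis ()) a) ≫ el m := by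
    rw [el_comp, (el m).map_act, el_basis]
  rw [this, Functor.map_comp, Category.assoc, hm, comp_zero]

/-- The graded submodule of the elements of `M` killed by a morphism in `QGr(R)`. -/
def GSub.killedBy {Z : QGr 𝒜} (c : (quotientFunctor 𝒜).obj M ⟶ Z) : GSub M where
  carrier i :=
    { carrier := {x | (quotientFunctor 𝒜).map (el x) ≫ c = 0}
      zero_mem' := by simp [el_zero]
      add_mem' := fun {x y} hx hy => by
        have hx : (quotientFunctor 𝒜).map (el x) ≫ c = 0 := hx
        have hy : (quotientFunctor 𝒜).map (el y) ≫ c = 0 := hy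
        simp [el_add, Functor.map_add, hx, hy]
      neg_mem' := fun {x} hx => by
        have hx : (quotientFunctor 𝒜).map (el x) ≫ c = 0 := hx
        simp [el_neg, Functor.map_neg, hx] }
  act_mem {i j l} h m a hm := el_act_comp_eq_zero c h m a hm

lemma GSub.mem_killedBy {Z : QGr 𝒜} {c : (quotientFunctor 𝒜).obj M ⟶ Z} {i : ℤ} {x : M.obj i} :
    x ∈ (GSub.killedBy c).carrier i ↔ (quotientFunctor 𝒜).map (el x) ≫ c = 0 := Iff.rfl

/-- In an abelian category a monomorphism is the kernel of its cokernel. In this form, inclusion can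
be tested on elements. -/
lemma subobject_le_iff {C : Type*} [Category* C] [Abelian C] {A : C} {X Y : Subobject A} :
    X ≤ Y ↔ X.arrow ≫ cokernel.π Y.arrow = 0 := by
  refine ⟨fun h => ?_, fun h => ?_⟩
  · rw [← Subobject.ofLE_arrow h, Category.assoc, cokernel.condition, comp_zero]
  · exact Subobject.le_of_comm (Abelian.monoLift Y.arrow X.arrow h) (Abelian.monoLift_comp _ _ _)

/-- The image of a Noetherian graded module in `QGr(R)` is a Noetherian object. -/
lemma GrMod.IsNoeth.isNoetherianObject (h : IsNoeth M) :
    IsNoetherianObject ((quotientFunctor 𝒜).obj M) := by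
  have hw : WellFoundedGT (GSub M) := h
  refine ⟨?_⟩
  -- A subobject X is sent to the elements of M whose morphism factors through X. The order can be
  -- recovered because elements are jointly epimorphic.
  refine StrictMono.wellFoundedGT (f := fun X : Subobject ((quotientFunctor 𝒜).obj M) =>
    GSub.killedBy (cokernel.π X.arrow)) (strictMono_of_le_iff_le fun X Y => ?_)
  refine ⟨fun hXY i x hx => ?_, fun hXY => ?_⟩
  · rw [GSub.mem_killedBy] at hx ⊢
    rw [← Abelian.monoLift_comp X.arrow _ hx, Category.assoc, subobject_le_iff.1 hXY, comp_zero]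
  · rw [subobject_le_iff]
    let e := (quotientFunctor 𝒜).objObjPreimageIso (X : QGr 𝒜)
    -- Up to an isomorphism of the source, the inclusion of X comes from a genuine morphism `φ.f`
    -- into M, all of whose values are elements of X and hence of Y.
    obtain ⟨φ, hφ⟩ := Localization.exists_rightFraction (quotientFunctor 𝒜)
      (torsion 𝒜).isoModSerre (e.hom ≫ X.arrow)
    have := isIso_quotientFunctor_map φ.hs
    have hf : (quotientFunctor 𝒜).map φ.s ≫ e.hom ≫ X.arrow = (quotientFunctor 𝒜).map φ.f := by
      rw [hφ, MorphismProperty.RightFraction.map_s_comp_map]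
    have h0 : (quotientFunctor 𝒜).map φ.f ≫ cokernel.π Y.arrow = 0 := by
      refine eq_zero_of_el_comp _ fun i x => ?_
      rw [← Functor.map_comp_assoc, el_comp]
      refine GSub.le_def.1 hXY i (φ.f.app i x) ?_
      rw [GSub.mem_killedBy, ← el_comp, Functor.map_comp, ← hf]
      simp
    rw [← hf, Category.assoc, Category.assoc] at h0
    simpa using h0

/-- Noetherian objects of `QGr(R)` are quotients of images of finite free modules. -/
lemma exists_epi_free (Y : QGr 𝒜) [IsNoetherianObject Y] :
    ∃ (ι : Type) (_ : Fintype ι) (d : ι → ℤ) (p : (quotientFunctor 𝒜).obj (free 𝒜 d) ⟶ Y), Epi p := by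
  let e := (quotientFunctor 𝒜).objObjPreimageIso Y
  let L := (quotientFunctor 𝒜).objPreimage Y
  have : IsNoetherianObject ((quotientFunctor 𝒜).obj L) := isNoetherianObject_of_mono e.hom
  -- The maximality argument of `GrMod.IsNoeth.exists_free`, with images in the quotient category:
  -- surjectivity modulo torsion is all that is available.
  let A : Set (Subobject ((quotientFunctor 𝒜).obj L)) :=
    {S | ∃ (ι : Type) (_ : Fintype ι) (d : ι → ℤ) (f : free 𝒜 d ⟶ L),
      S = imageSubobject ((quotientFunctor 𝒜).map f)}
  obtain ⟨S, ⟨ι, _, d, f, rfl⟩, hS⟩ := (wellFounded_gt (α := Subobject ((quotientFunctor 𝒜).obj L))).has_min A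
    ⟨_, Empty, inferInstance, fun _ => 0, 0, rfl⟩
  suffices Epi ((quotientFunctor 𝒜).map f) from
    ⟨ι, inferInstance, d, (quotientFunctor 𝒜).map f ≫ e.hom, inferInstance⟩
  refine Abelian.epi_of_cokernel_π_eq_zero _ (eq_zero_of_el_comp _ fun i x => ?_)
  obtain ⟨ι', _, d', f', ⟨g, hg⟩, ⟨g', hg'⟩⟩ := exists_extend f x
  have hle : imageSubobject ((quotientFunctor 𝒜).map f) ≤ imageSubobject ((quotientFunctor 𝒜).map f') := by
    rw [← hg, Functor.map_comp]
    exact imageSubobject_comp_le _ _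
  have he := hle.eq_of_not_lt (hS _ ⟨_, inferInstance, _, _, rfl⟩)
  have hc : (imageSubobject ((quotientFunctor 𝒜).map f)).arrow ≫ cokernel.π ((quotientFunctor 𝒜).map f) = 0 := by
    rw [← cancel_epi (factorThruImageSubobject ((quotientFunctor 𝒜).map f))]
    simp
  rw [← hg', Functor.map_comp, Category.assoc,
    ← imageSubobject_arrow_comp ((quotientFunctor 𝒜).map f'), Category.assoc]
  have : (imageSubobject ((quotientFunctor 𝒜).map f')).arrow ≫ cokernel.π ((quotientFunctor 𝒜).map f) = 0 := by
    rw [he] at hc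
    exact hc
  rw [this, comp_zero, comp_zero]

/-! ### Shifts of the structure sheaf -/

/-- The shift `R[n]` is free on one generator of degree `-n`. -/
noncomputable def shiftSelfIso (n : ℤ) :
    (shift 𝒜 n).obj (self 𝒜) ≅ free 𝒜 (fun _ : Unit => -n) :=
  let f : (shift 𝒜 n).obj (self 𝒜) ⟶ free 𝒜 (fun _ : Unit => -n) :=
    { app := fun i => AddMonoidHom.mk' (fun x => freeMk i (fun _ => x.1) fun _ => by
        have := x.2
        rwa [show i - -n = n + i by ring]) fun _ _ => rfl
      map_act := fun _ _ _ => rfl }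
  have : Mono f := mono_of_injective f fun i x y h =>
    Subtype.ext (congrFun (congrArg Subtype.val h) ())
  have : Epi f := epi_of_surjective f fun i v => ⟨⟨v.1 (), by
    have h : ∀ {j j' : ℤ}, j = j' → ∀ {y : R}, y ∈ intPiece 𝒜 j → y ∈ intPiece 𝒜 j' := by
      rintro j _ rfl y hy
      exact hy
    exact h (by ring) (free_mem v ())⟩, free_ext fun _ => rfl⟩
  have : IsIso f := isIso_of_mono_of_epi f
  asIso f

/-- The shift of the structure sheaf is the image of a free module with one generator. -/
noncomputable def qShiftStructureSheafIso (n : ℤ) : (qShift 𝒜 n).obj (structureSheaf 𝒜) ≅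
    (quotientFunctor 𝒜).obj (free 𝒜 (fun _ : Unit => -n)) :=
  (Localization.fac (GrMod.shift 𝒜 n ⋙ quotientFunctor 𝒜) (shift_inverts 𝒜 n)
    (quotientFunctor 𝒜)).app (self 𝒜) ≪≫ (quotientFunctor 𝒜).mapIso (shiftSelfIso n)

end
end NCProj

/-! ### Cohomological dimension and the cohomology of the structure sheaf -/

namespace NCProj

section

variable {k : Type w} [Field k] {R : Type u} [Ring R] [Algebra k R]
variable {𝒜 : ℕ → Submodule k R} [GradedAlgebra 𝒜] [IsNoetherianRing Rᵐᵒᵖ]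

open GrMod Abelian

lemma subsingleton_ext_of_iso {C : Type*} [Category* C] [Abelian C] [HasExt.{w} C] {X Y Z : C}
    {i : ℕ} (e : Y ≅ Z) (h : Subsingleton (Ext X Y i)) : Subsingleton (Ext X Z i) := by
  refine subsingleton_of_forall_eq 0 fun x => ?_
  have : (x.comp (Ext.mk₀ e.inv) (add_zero i)).comp (Ext.mk₀ e.hom) (add_zero i) = x := by
    rw [Ext.comp_assoc_of_third_deg_zero, Ext.mk₀_comp_mk₀, e.inv_hom_id, Ext.comp_mk₀_id]
  rw [← this, Subsingleton.elim (x.comp (Ext.mk₀ e.inv) (add_zero i)) 0, Ext.zero_comp]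

omit [IsNoetherianRing Rᵐᵒᵖ] in
lemma sum_app {M N : GrMod 𝒜} {ι : Type} (s : Finset ι) (f : ι → (M ⟶ N)) (i : ℤ) (x : M.obj i) :
    GrMod.Hom.app (Finset.sum (M := M ⟶ N) s f) i x = ∑ p ∈ s, (f p).app i x :=
  map_sum (AddMonoidHom.mk' (fun f : M ⟶ N => f.app i x) fun _ _ => rfl) f s

/-- The coordinates of a free module. -/
def freeProj {ι : Type} (d : ι → ℤ) (p : ι) : free 𝒜 d ⟶ free 𝒜 (fun _ : Unit => d p) where
  app l := AddMonoidHom.mk' (fun v => freeMk l (fun _ => v.1 p) fun _ => free_mem v p) fun _ _ => rfl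
  map_act _ _ _ := rfl

/-- If the cohomology of all shifts of the structure sheaf vanishes in degree `i`, so does that of
images of free modules. -/
lemma subsingleton_cohomology_free {i : ℕ}
    (h : ∀ n : ℤ, Subsingleton (cohomology 𝒜 i ((qShift 𝒜 n).obj (structureSheaf 𝒜))))
    {ι : Type} [Fintype ι] (d : ι → ℤ) :
    Subsingleton (cohomology 𝒜 i ((quotientFunctor 𝒜).obj (free 𝒜 d))) := by
  classical
  have h' : ∀ n : ℤ, Subsingleton
      (cohomology 𝒜 i ((quotientFunctor 𝒜).obj (free 𝒜 (fun _ : Unit => n)))) := fun n => by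
    have := subsingleton_ext_of_iso (qShiftStructureSheafIso (-n)) (h (-n))
    rwa [neg_neg] at this
  -- The identity is a finite sum of morphisms through rank one free modules, so every class is a
  -- sum of classes pushed through vanishing groups.
  have hid : 𝟙 (free 𝒜 d) = ∑ p, freeProj d p ≫ el (freeBasis p) := by
    ext l v
    refine Eq.trans ?_ (sum_app (M := free 𝒜 d) (N := free 𝒜 d) _ _ l v).symm
    rw [id_app]
    conv_lhs => rw [free_eq_sum v]
    refine Finset.sum_congr rfl fun p _ => ?_
    rw [comp_app, el_app]
    rfl
  refine subsingleton_of_forall_eq 0 fun x => ?_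
  rw [← Ext.comp_mk₀_id x, ← (quotientFunctor 𝒜).map_id (free 𝒜 d), hid, Functor.map_sum, Ext.mk₀_sum, Ext.comp_sum]
  refine Finset.sum_eq_zero fun p _ => ?_
  rw [Functor.map_comp, ← Ext.mk₀_comp_mk₀, ← Ext.comp_assoc_of_third_deg_zero]
  have := h' (d p)
  rw [Subsingleton.elim (x.comp (Ext.mk₀ ((quotientFunctor 𝒜).map (freeProj d p))) (add_zero i)) 0,
    Ext.zero_comp]

lemma nontrivial_gradedCohomology_iff (i : ℕ) (Y : QGr 𝒜) :
    Nontrivial (gradedCohomology 𝒜 i Y) ↔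
      ∃ n : ℤ, Nontrivial (cohomology 𝒜 i ((qShift 𝒜 n).obj Y)) := by
  classical
  constructor
  · intro h
    by_contra! hn
    obtain ⟨x, hx⟩ := exists_ne (0 : gradedCohomology 𝒜 i Y)
    refine hx (DFinsupp.ext fun n => ?_)
    have := hn n
    exact Subsingleton.elim _ _
  · rintro ⟨n, hn⟩
    exact (DirectSum.of_injective (β := fun n : ℤ => cohomology 𝒜 i ((qShift 𝒜 n).obj Y)) n).nontrivial

lemma isNoetherianObject_qShift_structureSheaf (n : ℤ) :
    IsNoetherianObject ((qShift 𝒜 n).obj (structureSheaf 𝒜)) := by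
  have := (isNoeth_free (𝒜 := 𝒜) (fun _ : Unit => -n)).isNoetherianObject
  exact isNoetherianObject_of_mono (qShiftStructureSheafIso n).hom

/-- In the top degree, non vanishing cohomology is detected by the shifts of the structure sheaf. -/
lemma exists_nontrivial_cohomology_qShift {i : ℕ} (Y : QGr 𝒜) [IsNoetherianObject Y]
    (hY : Nontrivial (cohomology 𝒜 i Y))
    (h : ∀ Z : QGr 𝒜, IsNoetherianObject Z → Subsingleton (cohomology 𝒜 (i + 1) Z)) :
    ∃ n : ℤ, Nontrivial (cohomology 𝒜 i ((qShift 𝒜 n).obj (structureSheaf 𝒜))) := by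
  by_contra! hn
  obtain ⟨ι, _, d, p, hp⟩ := exists_epi_free Y
  have hS : (ShortComplex.mk (kernel.ι p) p (kernel.condition p)).ShortExact :=
    { exact := ShortComplex.exact_kernel p }
  have := (isNoeth_free (𝒜 := 𝒜) d).isNoetherianObject
  have := h _ (isNoetherianObject_of_mono (kernel.ι p))
  obtain ⟨x, hx⟩ := exists_ne (0 : cohomology 𝒜 i Y)
  -- The obstruction to lifting `x` to the free object lies in H^{i+1} of the kernel, which is zero.
  obtain ⟨y, hy⟩ := Ext.covariant_sequence_exact₃ _ hS x rfl (Subsingleton.elim _ _)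
  have := subsingleton_cohomology_free hn d
  rw [Subsingleton.elim y 0, Ext.zero_comp] at hy
  exact hx hy.symm

/-- A supremum below ⊤ bounds the indices satisfying `P`. The largest of them fails `P` at its
successor, hence satisfies `Q`, and it dominates all others. -/
lemma sSup_natCast_eq_of_top {P Q : ℕ → Prop} (hQP : ∀ i, Q i → P i)
    (hPQ : ∀ i, P i → ¬ P (i + 1) → Q i)
    (h : sSup {c : WithBot ℕ∞ | ∃ i : ℕ, c = i ∧ P i} < ⊤) :
    sSup {c : WithBot ℕ∞ | ∃ i : ℕ, c = i ∧ P i} = sSup {c : WithBot ℕ∞ | ∃ i : ℕ, c = i ∧ Q i} := by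
  refine le_antisymm (sSup_le ?_) (sSup_le_sSup ?_)
  · rintro _ ⟨i, rfl, hi⟩
    obtain ⟨n, hn⟩ : ∃ n : ℕ, ∀ j, P j → j ≤ n := by
      by_contra! hn
      refine h.ne (eq_top_iff.2 ?_)
      rw [le_sSup_iff]
      intro b hb
      have hb' : ∀ n : ℕ, (n : WithBot ℕ∞) ≤ b := fun n => by
        obtain ⟨j, hj, hnj⟩ := hn n
        exact le_trans (by exact_mod_cast hnj.le) (hb ⟨j, rfl, hj⟩)
      induction b with
      | bot => exact absurd (hb' 0) (by simp)
      | coe b =>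
        have : b = ⊤ := ENat.eq_top_iff_forall_ge.2 fun n => by exact_mod_cast hb' n
        rw [this]
        rfl
    classical
    have hP := Nat.findGreatest_spec (hn i hi) hi
    have hle := Nat.le_findGreatest (hn i hi) hi
    refine le_trans (show (i : WithBot ℕ∞) ≤ (Nat.findGreatest P n : ℕ) by exact_mod_cast hle)
      (le_sSup ⟨_, rfl, hPQ _ hP fun h' => ?_⟩)
    have := Nat.le_findGreatest (hn _ h') h'
    omega
  · rintro _ ⟨i, rfl, hi⟩
    exact ⟨i, rfl, hQP i hi⟩

-- The shifts of the structure sheaf are themselves Noetherian, which gives one inequality; at the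
-- top degree they detect nonvanishing, which gives the other.
variable (𝒜) in
theorem cohomologicalDimension_eq (h : cohomologicalDimension 𝒜 < ⊤) :
    cohomologicalDimension 𝒜 =
      sSup {c : WithBot ℕ∞ | ∃ i : ℕ, c = i ∧
        Nontrivial (gradedCohomology 𝒜 i (structureSheaf 𝒜))} := by
  refine sSup_natCast_eq_of_top (fun i hi => ?_) (fun i hi hi' => ?_) h
  · obtain ⟨n, hn⟩ := (nontrivial_gradedCohomology_iff i _).1 hi
    exact ⟨_, isNoetherianObject_qShift_structureSheaf n, hn⟩
  · obtain ⟨Y, hY, hY'⟩ := hi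
    refine (nontrivial_gradedCohomology_iff i _).2 (exists_nontrivial_cohomology_qShift Y hY' ?_)
    intro Z hZ
    by_contra hs
    exact hi' ⟨Z, hZ, not_subsingleton_iff_nontrivial.1 hs⟩

end
end NCProj

namespace NCProj

section

variable {k : Type w} [Field k] {R : Type u} [Ring R] [Algebra k R]
variable {𝒜 : ℕ → Submodule k R} [GradedAlgebra 𝒜] [IsNoetherianRing Rᵐᵒᵖ]

open GrMod Abelian

/-! ### Extensions in `QGr(R)` come from extensions in `Gr(R)` -/

/-- The `Ext` groups of `Gr(R)`, in the same universe as those of `QGr(R)`. -/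
instance : HasExt.{max w (u + 1)} (GrMod 𝒜) := HasExt.standard _

variable {M N L : GrMod 𝒜}

omit [IsNoetherianRing Rᵐᵒᵖ] in
lemma GrMod.shortExact_ker (f : M ⟶ N) [Epi f] :
    (ShortComplex.mk (kerι f) f (kerι_comp f)).ShortExact where
  exact := ShortComplex.exact_of_f_is_kernel _ (kerIsLimit f)
  mono_f := mono_of_injective _ fun _ => Subtype.val_injective

instance GrMod.epi_truncMap (f : M ⟶ N) [Epi f] (n : ℤ) : Epi (truncMap f n) := by
  refine epi_of_surjective _ fun i x => ?_
  by_cases hi : i < n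
  · exact ⟨0, (map_zero _).trans (Subtype.ext (x.2 hi)).symm⟩
  · obtain ⟨y, hy⟩ := surjective_of_epi f i x.1
    exact ⟨⟨y, GSub.mem_trunc_of_le (by omega) y⟩, Subtype.ext hy⟩

/-- The kernel of a truncated morphism maps to the truncation of the kernel. -/
def GrMod.kerTruncMap (f : M ⟶ N) (n : ℤ) : ker (truncMap f n) ⟶ (GSub.trunc (ker f) n).toMod :=
  GSub.lift _
    { app := fun _ => AddMonoidHom.mk' (fun x => ⟨x.1.1, congrArg Subtype.val x.2⟩) fun _ _ => rfl
      map_act := fun _ _ _ => rfl }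
    fun _ x hi => Subtype.ext (x.1.2 hi)

/-- Morphisms onto `N` up to torsion admit lifts from a finite free cover of a truncation. -/
lemma GrMod.IsNoeth.exists_lift (hN : IsNoeth N) (s : L ⟶ N) (hs : torsion 𝒜 (coker s)) :
    ∃ (n : ℤ) (F : GrMod 𝒜) (_ : IsNoeth F) (q : F ⟶ (GSub.trunc N n).toMod) (_ : Epi q)
      (g : F ⟶ L), g ≫ s = q ≫ (GSub.trunc N n).ι := by
  classical
  obtain ⟨n, hn⟩ := hN.exists_surjective s hs
  obtain ⟨ι, _, d, q, hq⟩ := (hN.sub (GSub.trunc N n)).exists_free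
  -- In degrees at least n the map `s` is surjective; a generator of smaller degree goes to 0 in the
  -- truncation and is lifted by 0.
  have hx : ∀ p, ∃ y, s.app (d p) y = (GSub.trunc N n).ι.app (d p) (q.app (d p) (freeBasis p)) :=
    fun p => by
      by_cases h : n ≤ d p
      · exact hn _ h _
      · exact ⟨0, (map_zero _).trans
          (GSub.ι_app_mem (GSub.trunc N n) (q.app (d p) (freeBasis p)) (by omega)).symm⟩
  choose y hy using hx
  refine ⟨n, _, isNoeth_free d, q, hq, freeLift y, free_hom_ext fun p => ?_⟩
  rw [comp_app, freeLift_basis, hy]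
  rfl

/-- Morphisms in `QGr(R)` from the image of a Noetherian module are defined on a truncation. -/
lemma GrMod.IsNoeth.exists_hom (hN : IsNoeth N)
    (φ : (quotientFunctor 𝒜).obj N ⟶ (quotientFunctor 𝒜).obj M) :
    ∃ (n : ℤ) (f : (GSub.trunc N n).toMod ⟶ M),
      (quotientFunctor 𝒜).map f = (quotientFunctor 𝒜).map (GSub.trunc N n).ι ≫ φ := by
  obtain ⟨ψ, hψ⟩ := Localization.exists_rightFraction (quotientFunctor 𝒜)
    (torsion 𝒜).isoModSerre φ
  have := isIso_quotientFunctor_map ψ.hs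
  have hφ : (quotientFunctor 𝒜).map ψ.s ≫ φ = (quotientFunctor 𝒜).map ψ.f := by
    rw [hψ, MorphismProperty.RightFraction.map_s_comp_map]
  have hs := (isoModSerre_iff_ker_coker ψ.s).1 ψ.hs
  obtain ⟨n, F, hF, q, hq, g, hg⟩ := hN.exists_lift ψ.s hs.2
  -- The composite `g ≫ ψ.f` need not descend along the cover `q`. However, `g` sends ker q into the
  -- torsion module ker ψ.s, so the failure is torsion.
  have ht : torsion 𝒜 (GSub.range (kerι q ≫ g ≫ ψ.f)).toMod := by
    rintro i ⟨_, x, rfl⟩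
    refine IsTorsionElt.of_map _ (GSub.ι_injective _) ?_
    refine IsTorsionElt.map (M := ψ.X') ψ.f (i := i) (x := g.app i x.1) ?_
    have hx : ψ.s.app i (g.app i x.1) = 0 := by
      have h := congr_app hg i x.1
      rw [comp_app, comp_app, show q.app i x.1 = 0 from x.2, map_zero] at h
      exact h
    exact IsTorsionElt.map (kerι ψ.s) (hs.1 i ⟨g.app i x.1, hx⟩)
  have hk : IsNoeth (GSub.range (kerι q ≫ g ≫ ψ.f)).toMod :=
    (hF.isNoeth_ker q).of_surjective (GSub.lift _ (kerι q ≫ g ≫ ψ.f) fun _ x => ⟨x, rfl⟩) (by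
      rintro i ⟨_, x, rfl⟩
      exact ⟨x, rfl⟩)
  obtain ⟨n₁, hn₁⟩ := hk.exists_bound ht
  let n' := max n n₁
  let q' := truncMap q n'
  -- The failure is also Noetherian, hence zero in large degrees: beyond n' the map descends to the
  -- truncation.
  have hker : kerι q' ≫ (GSub.trunc F n').ι ≫ g ≫ ψ.f = 0 := by
    ext i x
    by_cases hi : n' ≤ i
    · have hx : q.app i x.1.1 = 0 := congrArg Subtype.val x.2
      exact congrArg Subtype.val (hn₁ i (le_trans (le_max_right _ _) hi)
        ⟨_, (⟨x.1.1, hx⟩ : (ker q).obj i), rfl⟩)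
    · have hx : (GSub.trunc F n').ι.app i x.1 = 0 := x.1.2 (by omega)
      change ψ.f.app i (g.app i ((GSub.trunc F n').ι.app i x.1)) = 0
      rw [hx, map_zero, map_zero]
  have hS := shortExact_ker q'
  let f' : (GSub.trunc (GSub.trunc N n).toMod n').toMod ⟶ M :=
    hS.gIsCokernel.desc (CokernelCofork.ofπ _ hker)
  have hf' : q' ≫ f' = (GSub.trunc F n').ι ≫ g ≫ ψ.f :=
    Cofork.IsColimit.π_desc hS.gIsCokernel
  refine ⟨n', truncTrunc N (le_max_left _ _) ≫ f', ?_⟩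
  have key : (quotientFunctor 𝒜).map f' = (quotientFunctor 𝒜).map
      ((GSub.trunc (GSub.trunc N n).toMod n').ι ≫ (GSub.trunc N n).ι) ≫ φ := by
    rw [← cancel_epi ((quotientFunctor 𝒜).map q'), ← Functor.map_comp, hf', ← Functor.map_comp_assoc,
      ← Category.assoc q', truncMap_ι, Category.assoc, ← hg, ← Category.assoc, Functor.map_comp,
      ← hφ, ← Functor.map_comp_assoc, Category.assoc]
  rw [Functor.map_comp, key, ← Functor.map_comp_assoc, truncTrunc_ι]

/-- Extensions in `QGr(R)` of images of graded modules, the first of which is Noetherian, come from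
extensions of a truncation. -/
lemma GrMod.IsNoeth.exists_ext (i : ℕ) : ∀ {N : GrMod 𝒜} (_ : IsNoeth N)
    (e : Ext.{max w (u + 1)} ((quotientFunctor 𝒜).obj N) ((quotientFunctor 𝒜).obj M) i),
    ∃ n₀ : ℤ, ∀ n, n₀ ≤ n → ∃ e' : Ext.{max w (u + 1)} (GSub.trunc N n).toMod M i,
      e'.mapExactFunctor (quotientFunctor 𝒜) =
        (Ext.mk₀ ((quotientFunctor 𝒜).map (GSub.trunc N n).ι)).comp e (zero_add i) := by
  induction i with
  | zero =>
    intro N hN e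
    obtain ⟨φ, rfl⟩ := (Ext.mk₀_bijective _ _).2 e
    obtain ⟨n₀, f, hf⟩ := hN.exists_hom φ
    refine ⟨n₀, fun n hn => ⟨Ext.mk₀ (truncLE N hn ≫ f), ?_⟩⟩
    rw [Ext.mapExactFunctor_mk₀, Ext.mk₀_comp_mk₀, Functor.map_comp, hf, ← Functor.map_comp_assoc,
      truncLE_ι]
  | succ i ih =>
    intro N hN e
    -- The epimorphism lives in the quotient category. Calculus of fractions turns it into a graded
    -- morphism `ψ.f` with torsion cokernel, and then into a free cover `q` of a truncation, which
    -- still kills the class.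
    obtain ⟨X', p, _, hp⟩ := e.exists_epi_comp_eq_zero
    let E := (quotientFunctor 𝒜).objObjPreimageIso X'
    obtain ⟨ψ, hψ⟩ := Localization.exists_rightFraction (quotientFunctor 𝒜)
      (torsion 𝒜).isoModSerre (E.hom ≫ p)
    have := isIso_quotientFunctor_map ψ.hs
    have hf : (quotientFunctor 𝒜).map ψ.s ≫ E.hom ≫ p = (quotientFunctor 𝒜).map ψ.f := by
      rw [hψ, MorphismProperty.RightFraction.map_s_comp_map]
    have : Epi ((quotientFunctor 𝒜).map ψ.f) := by
      rw [← hf]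
      infer_instance
    obtain ⟨n, F, hF, q, hq, g, hg⟩ := hN.exists_lift ψ.f (torsion_coker_of_epi_map ψ.f)
    have hS := shortExact_ker q
    have hSπ := hS.map_of_exact (quotientFunctor 𝒜)
    let e₀ := (Ext.mk₀ ((quotientFunctor 𝒜).map (GSub.trunc N n).ι)).comp e (zero_add _)
    have h0 : (Ext.mk₀ ((quotientFunctor 𝒜).map q)).comp e₀ (zero_add _) = 0 := by
      rw [Ext.mk₀_comp_mk₀_assoc, ← Functor.map_comp, ← hg, Functor.map_comp, ← hf,
        ← Category.assoc, ← Category.assoc, ← Ext.mk₀_comp_mk₀_assoc, hp, Ext.comp_zero]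
    -- Dimension shift: the class restricted to the truncation is the connecting class times some
    -- `e₁` of degree `i` on ker q, to which induction applies.
    obtain ⟨e₁, he₁⟩ := Ext.contravariant_sequence_exact₃ hSπ _ e₀ h0 (add_comm 1 i)
    obtain ⟨n₁, hn₁⟩ := ih (hF.isNoeth_ker q) e₁
    -- One truncation degree must suit both ker q and N; hence the statement is proved for all large
    -- n.
    refine ⟨max n n₁, fun n' hn' => ?_⟩
    obtain ⟨e', he'⟩ := hn₁ n' (le_trans (le_max_right _ _) hn')
    have hS' := shortExact_ker (truncMap q n')
    let e'' := hS'.extClass.comp ((Ext.mk₀ (kerTruncMap q n')).comp e' (zero_add _)) (add_comm 1 i)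
    have he'' : e''.mapExactFunctor (quotientFunctor 𝒜) =
        (Ext.mk₀ ((quotientFunctor 𝒜).map (GSub.trunc (GSub.trunc N n).toMod n').ι)).comp e₀
          (zero_add _) := by
      -- Truncating the sequence gives a morphism of short exact sequences, and naturality of the
      -- connecting class compares the lifted class with the given one.
      let α : ShortComplex.mk _ _ (kerι_comp (truncMap q n')) ⟶ ShortComplex.mk _ _ (kerι_comp q) :=
        { τ₁ := kerTruncMap q n' ≫ (GSub.trunc _ n').ι
          τ₂ := (GSub.trunc F n').ι
          τ₃ := (GSub.trunc _ n').ι }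
      rw [← he₁]
      refine Ext.mapExactFunctor_extClass_comp (quotientFunctor 𝒜) α hS' hS _ _ e₁ ?_
      rw [Ext.mapExactFunctor_comp, Ext.mapExactFunctor_mk₀, he']
      refine (Ext.mk₀_comp_mk₀_assoc _ _ _).trans ?_
      rw [← Functor.map_comp]
    refine ⟨(Ext.mk₀ (truncTrunc N (le_trans (le_max_left _ _) hn'))).comp e'' (zero_add _), ?_⟩
    rw [Ext.mapExactFunctor_comp, he'', Ext.mapExactFunctor_mk₀, Ext.mk₀_comp_mk₀_assoc,
      Ext.mk₀_comp_mk₀_assoc, ← Functor.map_comp, ← Functor.map_comp, Category.assoc, truncTrunc_ι]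

end
end NCProj

namespace NCProj

/-! ### Matrices acting on left modules -/

section Matrices

open Matrix

variable {R : Type u} [Ring R] {ι κ μ : Type} [Fintype κ] [Fintype μ]

/-- The action of a matrix on vectors with entries in a left module. -/
def smulVec (L : Type u) [AddCommGroup L] [Module R L] (A : Matrix ι κ R) : (κ → L) →+ (ι → L) :=
  AddMonoidHom.mk' (fun v p => ∑ q, A p q • v q) fun v v' => by
    ext p
    simp [smul_add, Finset.sum_add_distrib]

section

variable {L L' : Type u} [AddCommGroup L] [Module R L] [AddCommGroup L'] [Module R L']

lemma smulVec_apply (A : Matrix ι κ R) (v : κ → L) (p : ι) :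
    smulVec L A v p = ∑ q, A p q • v q := rfl

lemma smulVec_smulVec (A : Matrix ι κ R) (B : Matrix κ μ R) (v : μ → L) :
    smulVec L A (smulVec L B v) = smulVec L (A * B) v := by
  ext p
  simp only [smulVec_apply, Matrix.mul_apply, Finset.smul_sum, Finset.sum_smul, smul_smul]
  exact Finset.sum_comm

lemma smulVec_map (A : Matrix ι κ R) (f : L →ₗ[R] L') (v : κ → L) (p : ι) :
    smulVec L' A (fun q => f (v q)) p = f (smulVec L A v p) := by
  simp [smulVec_apply]

end

/-- Exactness of `L^μ → L^κ → L^ι`. -/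
def ExactOn (L : Type u) [AddCommGroup L] [Module R L] (A : Matrix ι κ R) (B : Matrix κ μ R) : Prop :=
  ∀ v : κ → L, smulVec L A v = 0 → ∃ u, smulVec L B u = v

/-- Exactness is preserved by tensoring with projective modules. -/
lemma ExactOn.of_projective {A : Matrix ι κ R} {B : Matrix κ μ R} (h : ExactOn R A B)
    (L : Type u) [AddCommGroup L] [Module R L] [Module.Projective R L] : ExactOn L A B := by
  classical
  intro v hv
  -- A section of the free cover with basis L gives R-valued coordinates; the equation is solved
  -- over R in each coordinate and then recombined.
  obtain ⟨s, hs⟩ := Module.Projective.out (R := R) (P := L)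
  have hx : ∀ x : L, ∃ u : μ → R, smulVec R B u = fun q => s (v q) x := fun x => by
    refine h _ (funext fun p => ?_)
    have := congrArg (fun z => s z x) (congrFun hv p)
    simpa [smulVec_apply, Finsupp.finsetSum_apply] using this
  choose U hU using hx
  -- Summation is restricted to the supports: outside them the chosen solution `U x` may be nonzero.
  let T : Finset L := Finset.univ.biUnion fun q => (s (v q)).support
  refine ⟨fun r => ∑ x ∈ T, U x r • x, funext fun q => ?_⟩
  have h1 : v q = ∑ x ∈ T, s (v q) x • x := by
    conv_lhs => rw [← hs (v q), Finsupp.linearCombination_apply]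
    exact Finsupp.sum_of_support_subset _
      (Finset.subset_biUnion_of_mem (fun q => (s (v q)).support) (Finset.mem_univ q)) _ (by simp)
  rw [h1, smulVec_apply]
  simp only [Finset.smul_sum, smul_smul]
  rw [Finset.sum_comm]
  refine Finset.sum_congr rfl fun x _ => ?_
  rw [← congrFun (hU x) q, smulVec_apply, Finset.sum_smul]
  rfl

/-- A free resolution remains exact in degrees larger than the projective dimension of `L` after
tensoring with `L`. -/
lemma exactOn_of_hasProjectiveDimensionLE {ι : ℕ → Type} [∀ j, Fintype (ι j)]
    (A : ∀ j, Matrix (ι j) (ι (j + 1)) R) (hA : ∀ j, A j * A (j + 1) = 0)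
    (hex : ∀ j, ExactOn R (A j) (A (j + 1))) (m : ℕ) :
    ∀ (L : ModuleCat.{u} R) (_ : HasProjectiveDimensionLE L m) (j : ℕ) (_ : m ≤ j),
      ExactOn L (A j) (A (j + 1)) := by
  induction m with
  | zero =>
    intro L hL j _
    have : Projective L := projective_iff_hasProjectiveDimensionLE_zero L |>.2 hL
    have : Module.Projective R L := (IsProjective.iff_projective (R := R) L).2 this
    exact (hex j).of_projective L
  | succ m ih =>
    intro L hL j hj v hv
    obtain ⟨j, rfl⟩ : ∃ i, j = i + 1 := ⟨j - 1, by omega⟩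
    -- Dimension shift 0 → K → F → L → 0 with F free. In terms of Tor, exactness at index j is the
    -- vanishing of Tor_{j+1}, so passing to K lowers the index by one.
    let φ : (L →₀ R) →ₗ[R] L := Finsupp.linearCombination R id
    have hφ : Function.Surjective φ := fun x => ⟨Finsupp.single x 1, by simp [φ]⟩
    have hP : Projective (ModuleCat.of R (L →₀ R)) :=
      (IsProjective.iff_projective (R := R) (L →₀ R)).1 inferInstance
    have hK : HasProjectiveDimensionLE (ModuleCat.of R (LinearMap.ker φ)) m :=
      ((LinearMap.shortExact_shortComplexKer hφ).hasProjectiveDimensionLT_X₃_iff m hP).1 hL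
    choose g hg using hφ
    let w : ι (j + 1 + 1) → (L →₀ R) := fun q => g (v q)
    have hw : (fun q => φ (w q)) = v := funext fun q => hg (v q)
    let k : ι (j + 1) → LinearMap.ker φ := fun p => ⟨smulVec (L →₀ R) (A (j + 1)) w p, by
      rw [LinearMap.mem_ker, ← smulVec_map, hw, hv]
      rfl⟩
    have hk : (fun p => (LinearMap.ker φ).subtype (k p)) = smulVec (L →₀ R) (A (j + 1)) w := rfl
    -- Applying the matrix to a lift `w` of `v` gives a cycle `k` over K; by induction it is a
    -- boundary over K.
    obtain ⟨t, ht⟩ := ih _ hK j (by omega) k (funext fun p => Subtype.ext (by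
      refine (smulVec_map (A j) (LinearMap.ker φ).subtype k p).symm.trans ?_
      rw [hk, smulVec_smulVec, hA]
      simp [smulVec_apply]))
    let t' : ι (j + 1 + 1) → (L →₀ R) := fun q => (LinearMap.ker φ).subtype (t q)
    have ht' : smulVec (L →₀ R) (A (j + 1)) t' = smulVec (L →₀ R) (A (j + 1)) w := funext fun p => by
      rw [← hk]
      exact (smulVec_map _ _ _ _).trans (congrArg _ (congrFun ht p))
    -- Correcting the lift by `t'` makes it a cycle over F without changing its image in L, and F is
    -- projective.
    obtain ⟨z, hz⟩ := (hex (j + 1)).of_projective (L →₀ R) (w - t') (by rw [map_sub, ht', sub_self])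
    refine ⟨fun r => φ (z r), funext fun q => ?_⟩
    rw [smulVec_map, hz, Pi.sub_apply, map_sub, show φ (t' q) = 0 from (t q).2, sub_zero]
    exact hg (v q)

/-- If `R^μ → R^κ → R^ι` remains exact after tensoring with any left module, then its second map
has a generalized inverse. -/
lemma exists_generalized_inverse [Fintype ι] {A : Matrix ι κ R} {B : Matrix κ μ R} (hAB : A * B = 0)
    (h : ∀ L : ModuleCat.{u} R, ExactOn L A B) : ∃ H : Matrix κ ι R, A * H * A = A := by
  classical
  -- The test module is R^κ modulo the rows of A. Its vector of basis classes is killed by A by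
  -- construction, so exactness places it in the image of B.
  let W : Submodule R (κ → R) := Submodule.span R (Set.range A)
  obtain ⟨u, hu⟩ := h (ModuleCat.of R ((κ → R) ⧸ W)) (fun q => W.mkQ (Pi.single q 1)) (by
    ext p
    rw [smulVec_map (L := κ → R) A W.mkQ]
    have : smulVec (κ → R) A (fun q => Pi.single q 1) p = A p := by
      ext q
      simp [smulVec_apply, Finset.sum_apply, Pi.single_apply]
    rw [this]
    exact (Submodule.Quotient.mk_eq_zero W).2 (Submodule.subset_span ⟨p, rfl⟩))
  choose X hX using fun r => W.mkQ_surjective (u r)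
  have hmem : ∀ q, Pi.single q 1 - smulVec (κ → R) B X q ∈ W := fun q => by
    rw [← Submodule.Quotient.mk_eq_zero, Submodule.Quotient.mk_sub, sub_eq_zero]
    have h1 := congrFun hu q
    have h2 := smulVec_map B W.mkQ X q
    simp only [hX] at h2
    exact h1.symm.trans h2
  choose H hH using fun q => (Submodule.mem_span_range_iff_exists_fun R).1 (hmem q)
  refine ⟨Matrix.of H, ?_⟩
  -- Lifting to R^κ, the identity differs from BX by combinations of rows of A: 1 = BX + HA.
  -- Multiplying by A on the left removes the term in B.
  have hHA : Matrix.of H * A = 1 - B * Matrix.of X := by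
    ext q q'
    have := congrFun (hH q) q'
    simp only [Finset.sum_apply, Pi.smul_apply, smul_eq_mul, Pi.sub_apply, smulVec_apply] at this
    simp only [Matrix.mul_apply, Matrix.sub_apply, Matrix.one_apply, Matrix.of_apply]
    rw [this, Pi.single_apply]
    simp [eq_comm]
  rw [Matrix.mul_assoc, hHA, Matrix.mul_sub, ← Matrix.mul_assoc, hAB]
  simp

end Matrices

end NCProj

namespace NCProj

section

variable {k : Type w} [Field k] {R : Type u} [Ring R] [Algebra k R]
variable {𝒜 : ℕ → Submodule k R} [GradedAlgebra 𝒜]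

open GrMod

/-! ### Matrices of morphisms of graded free modules -/

section Matrices

variable {ι κ μ : Type} [Fintype κ] [DecidableEq κ] {d : κ → ℤ} {e : ι → ℤ} {c : μ → ℤ}

/-- The matrix of a morphism of graded free modules. -/
def toMatrix (f : free 𝒜 d ⟶ free 𝒜 e) : Matrix ι κ R :=
  Matrix.of fun p q => (f.app (d q) (freeBasis q)).1 p

omit [Fintype κ] in
lemma toMatrix_mem (f : free 𝒜 d ⟶ free 𝒜 e) (p : ι) (q : κ) :
    toMatrix f p q ∈ intPiece 𝒜 (d q - e p) := free_mem _ p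

lemma hom_apply_coe (f : free 𝒜 d ⟶ free 𝒜 e) {l : ℤ} (v : (free 𝒜 d).obj l) :
    (f.app l v).1 = smulVec R (toMatrix f) v.1 := by
  rw [free_hom_apply]
  refine (map_sum (Submodule.pi Set.univ fun p => intPiece 𝒜 (l - e p)).toAddSubgroup.subtype
    _ _).trans ?_
  funext p
  rw [Finset.sum_apply, smulVec_apply]
  refine Finset.sum_congr rfl fun q _ => ?_
  refine (free_sm _ _ _).trans ?_
  rw [comp_of_mem (free_mem v q)]
  rfl

lemma toMatrix_injective {f g : free 𝒜 d ⟶ free 𝒜 e} (h : toMatrix f = toMatrix g) : f = g :=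
  free_hom_ext fun q => free_ext fun p => congrFun (congrFun h p) q

lemma toMatrix_comp [Fintype μ] [DecidableEq μ] (f : free 𝒜 c ⟶ free 𝒜 d)
    (g : free 𝒜 d ⟶ free 𝒜 e) : toMatrix (f ≫ g) = toMatrix g * toMatrix f := by
  ext p r
  refine (congrFun (hom_apply_coe g (f.app (c r) (freeBasis r))) p).trans ?_
  rw [smulVec_apply, Matrix.mul_apply]
  rfl

lemma app_compVec (f : free 𝒜 d ⟶ free 𝒜 e) (l : ℤ) (w : κ → R) :
    f.app l (compVec d l w) = compVec e l (smulVec R (toMatrix f) w) := by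
  refine free_ext fun p => ?_
  rw [hom_apply_coe, compVec_apply, smulVec_apply, smulVec_apply, map_sum]
  refine Finset.sum_congr rfl fun q _ => ?_
  exact (comp_mul_left (by omega) (toMatrix_mem f p q) (w q)).symm

/-- An exact sequence of graded free modules gives an exact sequence of matrices. -/
lemma exactOn_toMatrix [Fintype μ] [DecidableEq μ] (f : free 𝒜 c ⟶ free 𝒜 d)
    (g : free 𝒜 d ⟶ free 𝒜 e)
    (h : ∀ l (v : (free 𝒜 d).obj l), g.app l v = 0 → ∃ u, f.app l u = v) :
    ExactOn R (toMatrix g) (toMatrix f) := by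
  intro w hw
  have hl : ∀ l, ∃ u, f.app l u = compVec d l w := fun l => h l _ (by
    rw [app_compVec, hw, map_zero])
  choose u hu using hl
  -- An ungraded vector is the finite sum of its components, and each component can be lifted by
  -- graded exactness.
  obtain ⟨s, hs⟩ := exists_sum_compVec 𝒜 d w
  refine ⟨∑ l ∈ s, (u l).1, ?_⟩
  rw [map_sum, ← hs]
  exact Finset.sum_congr rfl fun l _ => by rw [← hu, hom_apply_coe]

/-- The homogeneous part of degree `0` of a matrix. -/
def ofMatrix [Fintype ι] (H : Matrix κ ι R) : free 𝒜 e ⟶ free 𝒜 d :=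
  freeLift fun p => compVec d (e p) fun q => H q p

omit [Fintype κ] [DecidableEq κ] in
lemma toMatrix_ofMatrix [Fintype ι] [DecidableEq ι] (H : Matrix κ ι R) (q : κ) (p : ι) :
    toMatrix (ofMatrix H : free 𝒜 e ⟶ free 𝒜 d) q p = comp 𝒜 (e p - d q) (H q p) := by
  refine (congrArg (fun z : (free 𝒜 d).obj (e p) => z.1 q) (freeLift_basis _ p)).trans ?_
  rfl

/-- Both outer factors have homogeneous entries, so taking the appropriate component of each entry
of the identity leaves only the degree 0 part of `H`. -/
lemma comp_ofMatrix_comp [Fintype ι] [DecidableEq ι] (f : free 𝒜 d ⟶ free 𝒜 e) {H : Matrix κ ι R}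
    (h : toMatrix f * H * toMatrix f = toMatrix f) : f ≫ ofMatrix H ≫ f = f := by
  refine toMatrix_injective ?_
  rw [toMatrix_comp, toMatrix_comp]
  ext p q
  have h' := congrArg (comp 𝒜 (d q - e p)) (congrFun (congrFun h p) q)
  rw [comp_of_mem (toMatrix_mem f p q)] at h'
  rw [← h', Matrix.mul_apply, Matrix.mul_apply, map_sum]
  refine Finset.sum_congr rfl fun p' _ => ?_
  rw [Matrix.mul_apply, Matrix.mul_apply, Finset.sum_mul, Finset.sum_mul, map_sum]
  refine Finset.sum_congr rfl fun q' _ => ?_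
  rw [toMatrix_ofMatrix, comp_mul_right (i := e p' - e p) (by omega) _ (toMatrix_mem f p' q),
    comp_mul_left (j := e p' - d q') (by omega) (toMatrix_mem f p q')]

end Matrices

/-! ### Syzygies -/

variable [IsNoetherianRing Rᵐᵒᵖ]

variable (𝒜) in
/-- Noetherian graded modules. -/
abbrev NoethMod := {M : GrMod 𝒜 // IsNoeth M}

namespace NoethMod

/-- The index set of a finite set of generators. -/
def gens (Z : NoethMod 𝒜) : Type := Z.2.exists_free.choose

noncomputable instance (Z : NoethMod 𝒜) : Fintype Z.gens := Z.2.exists_free.choose_spec.choose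

noncomputable instance (Z : NoethMod 𝒜) : DecidableEq Z.gens := Classical.decEq _

/-- The degrees of the generators. -/
noncomputable def deg (Z : NoethMod 𝒜) : Z.gens → ℤ := Z.2.exists_free.choose_spec.choose_spec.choose

/-- A finite free cover. -/
noncomputable def cover (Z : NoethMod 𝒜) : free 𝒜 Z.deg ⟶ Z.1 :=
  Z.2.exists_free.choose_spec.choose_spec.choose_spec.choose

instance (Z : NoethMod 𝒜) : Epi Z.cover :=
  Z.2.exists_free.choose_spec.choose_spec.choose_spec.choose_spec

/-- The first syzygy. -/
noncomputable def next (Z : NoethMod 𝒜) : NoethMod 𝒜 := ⟨ker Z.cover, (isNoeth_free Z.deg).isNoeth_ker Z.cover⟩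

/-- The inclusion of the first syzygy in the free cover. -/
noncomputable def nextι (Z : NoethMod 𝒜) : Z.next.1 ⟶ free 𝒜 Z.deg := kerι Z.cover

instance (Z : NoethMod 𝒜) : Mono Z.nextι := mono_of_injective _ fun _ => Subtype.val_injective

/-- The iterated syzygies. -/
noncomputable def syz (Z : NoethMod 𝒜) : ℕ → NoethMod 𝒜
  | 0 => Z
  | j + 1 => (Z.syz j).next

/-- The differentials of the free resolution. -/
noncomputable def diff (Z : NoethMod 𝒜) : free 𝒜 Z.next.deg ⟶ free 𝒜 Z.deg := Z.next.cover ≫ Z.nextι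

lemma shortExact (Z : NoethMod 𝒜) :
    (ShortComplex.mk Z.nextι Z.cover (kerι_comp Z.cover)).ShortExact := shortExact_ker Z.cover

lemma diff_exact (Z : NoethMod 𝒜) (l : ℤ) (v : (free 𝒜 Z.next.deg).obj l)
    (h : Z.diff.app l v = 0) : ∃ u, Z.next.diff.app l u = v := by
  have hv : Z.next.cover.app l v = 0 := injective_of_mono Z.nextι l (h.trans (map_zero _).symm)
  obtain ⟨u, hu⟩ := surjective_of_epi Z.next.next.cover l ⟨v, hv⟩
  exact ⟨u, congrArg Subtype.val hu⟩

lemma diff_comp (Z : NoethMod 𝒜) : Z.next.diff ≫ Z.diff = 0 := by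
  have : Z.next.nextι ≫ Z.next.cover = 0 := kerι_comp _
  rw [diff, diff, Category.assoc, reassoc_of% this, zero_comp, comp_zero]

/-- The differential is an epimorphism followed by a monomorphism. Cancelling both leaves a
retraction of the free cover onto the first syzygy, so the sequence splits and `Z` is a summand of a
free module. -/
lemma projective_of_generalized_inverse (Z : NoethMod 𝒜) (h : free 𝒜 Z.deg ⟶ free 𝒜 Z.next.deg)
    (hh : Z.diff ≫ h ≫ Z.diff = Z.diff) : Projective Z.1 := by
  have hr : Z.nextι ≫ h ≫ Z.next.cover = 𝟙 _ := by
    rw [← cancel_epi Z.next.cover, ← cancel_mono Z.nextι]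
    simpa [diff] using hh
  let σ := ShortComplex.Splitting.ofExactOfRetraction _ Z.shortExact.exact _ hr Z.shortExact.epi_g
  exact Retract.projective (Y := free 𝒜 Z.deg) ⟨σ.s, Z.cover, σ.s_g⟩

lemma hasProjectiveDimensionLE_of_syz (m : ℕ) : ∀ (Z : NoethMod 𝒜) (_ : Projective (Z.syz m).1),
    HasProjectiveDimensionLE Z.1 m := by
  induction m with
  | zero => exact fun Z h => (projective_iff_hasProjectiveDimensionLE_zero _).1 h
  | succ m ih =>
    intro Z h
    -- `syz` applies `next` last, whereas the induction peels off the first syzygy.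
    have hs : ∀ j, Z.next.syz j = Z.syz (j + 1) := fun j => by
      induction j with
      | zero => rfl
      | succ j hj => rw [syz, hj]; rfl
    have := ih Z.next (by rwa [hs])
    exact (Z.shortExact.hasProjectiveDimensionLT_X₃_iff m (inferInstanceAs (Projective (free 𝒜 _)))).2 this

/-- Over a ring of left global dimension at most `d`, Noetherian graded right modules have
projective dimension at most `d`. -/
theorem hasProjectiveDimensionLE (Z : NoethMod 𝒜) {d : ℕ} (h : leftGlobalDimension R ≤ d) :
    HasProjectiveDimensionLE Z.1 d := by
  refine hasProjectiveDimensionLE_of_syz d Z ?_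
  let A : ∀ j, Matrix (Z.syz j).gens (Z.syz (j + 1)).gens R := fun j => toMatrix (Z.syz j).diff
  have hA : ∀ j, A j * A (j + 1) = 0 := fun j => by
    refine (toMatrix_comp (Z.syz j).next.diff (Z.syz j).diff).symm.trans ?_
    rw [diff_comp]
    rfl
  have hex : ∀ j, ExactOn R (A j) (A (j + 1)) := fun j =>
    exactOn_toMatrix (Z.syz j).next.diff (Z.syz j).diff (Z.syz j).diff_exact
  -- Index d expresses Tor_{d+1}(Z, L) = 0 for all L, that is, Tor_1 of the d-th syzygy vanishes.
  obtain ⟨H, hH⟩ := exists_generalized_inverse (hA d) fun L =>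
    exactOn_of_hasProjectiveDimensionLE A hA hex d L
      ((projectiveDimension_le_iff L d).1 ((le_iSup (fun M : ModuleCat.{u} R =>
        projectiveDimension M) L).trans h)) d le_rfl
  exact projective_of_generalized_inverse _ (ofMatrix H) (comp_ofMatrix_comp _ hH)

end NoethMod

/-! ### The cohomological dimension and the left global dimension -/

/-- `R` is free on one generator of degree `0`. -/
noncomputable def selfIso : self 𝒜 ≅ free 𝒜 (fun _ : Unit => 0) :=
  let f : self 𝒜 ⟶ free 𝒜 (fun _ : Unit => 0) :=
    { app := fun i => AddMonoidHom.mk' (fun x => freeMk i (fun _ => x.1) fun _ => by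
        rw [sub_zero]
        exact x.2) fun _ _ => rfl
      map_act := fun _ _ _ => rfl }
  have : Mono f := mono_of_injective f fun i x y h =>
    Subtype.ext (congrFun (congrArg Subtype.val h) ())
  have : Epi f := epi_of_surjective f fun i v => ⟨⟨v.1 (), by
    have h : ∀ {j j' : ℤ}, j = j' → ∀ {y : R}, y ∈ intPiece 𝒜 j → y ∈ intPiece 𝒜 j' := by
      rintro j _ rfl y hy
      exact hy
    exact h (by ring) (free_mem v ())⟩, free_ext fun _ => rfl⟩
  have : IsIso f := isIso_of_mono_of_epi f
  asIso f

instance : Projective (self 𝒜) := Projective.of_iso selfIso.symm inferInstance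

variable (𝒜) in
lemma isNoeth_self : IsNoeth (self 𝒜) :=
  (isNoeth_free _).of_surjective selfIso.inv (surjective_of_epi _)

omit [IsNoetherianRing Rᵐᵒᵖ] in
lemma shortExact_coker {M N : GrMod 𝒜} (f : M ⟶ N) [Mono f] :
    (ShortComplex.mk f (cokerπ f) (comp_cokerπ f)).ShortExact where
  exact := ShortComplex.exact_of_g_is_cokernel _ (cokerIsColimit f)
  epi_g := epi_of_surjective _ (cokerπ_surjective f)

lemma eq_zero_of_mk₀_comp_eq_zero {C : Type*} [Category* C] [Abelian C] [HasExt.{w} C] {X X' Y : C}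
    (f : X' ⟶ X) [IsIso f] {n : ℕ} (e : Abelian.Ext X Y n)
    (h : (Abelian.Ext.mk₀ f).comp e (zero_add n) = 0) : e = 0 := by
  rw [← Abelian.Ext.mk₀_id_comp e, ← IsIso.inv_hom_id f, ← Abelian.Ext.mk₀_comp_mk₀_assoc, h,
    Abelian.Ext.comp_zero]

/-- The cohomology of `Proj R` vanishes in degrees not less than the left global dimension of `R`. -/
lemma subsingleton_cohomology_of_leftGlobalDimension_le {d : ℕ} (h : leftGlobalDimension R ≤ d + 1)
    {i : ℕ} (hi : d + 1 ≤ i) (Y : QGr 𝒜) : Subsingleton (cohomology 𝒜 i Y) := by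
  let E := (quotientFunctor 𝒜).objObjPreimageIso Y
  refine subsingleton_ext_of_iso E (subsingleton_of_forall_eq 0 fun e => ?_)
  -- The class, restricted to R_{≥n}, lifts to graded modules; it suffices to see that the lift is
  -- zero.
  obtain ⟨n, hn⟩ := (isNoeth_self 𝒜).exists_ext i e
  obtain ⟨e', he'⟩ := hn n le_rfl
  have hS := shortExact_coker (GSub.trunc (self 𝒜) n).ι
  have hc := NoethMod.hasProjectiveDimensionLE (𝒜 := 𝒜)
    ⟨_, (isNoeth_self 𝒜).isNoeth_coker (GSub.trunc (self 𝒜) n).ι⟩ (d := d + 1) (by exact_mod_cast h)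
  -- R_{≥n} is the first syzygy of R/R_{≥n} in its presentation by the projective module R, which
  -- gains one degree over the global dimension.
  have : HasProjectiveDimensionLT (GSub.trunc (self 𝒜) n).toMod (d + 1) :=
    (hS.hasProjectiveDimensionLT_X₃_iff d (inferInstanceAs (Projective (self 𝒜)))).1 hc
  rw [Abelian.Ext.eq_zero_of_hasProjectiveDimensionLT e' (d + 1) hi,
    Abelian.Ext.mapExactFunctor_zero] at he'
  exact eq_zero_of_mk₀_comp_eq_zero ((quotientFunctor 𝒜).map (GSub.trunc (self 𝒜) n).ι) e he'.symm

/-- If `R` has left global dimension `0`, then `Proj R` is empty. -/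
lemma isZero_structureSheaf (h : leftGlobalDimension R ≤ (0 : ℕ)) : IsZero (structureSheaf 𝒜) := by
  let i := (GSub.trunc (self 𝒜) 1).ι
  have hc := NoethMod.hasProjectiveDimensionLE (𝒜 := 𝒜)
    ⟨_, (isNoeth_self 𝒜).isNoeth_coker i⟩ h
  have : Projective (coker i) := (projective_iff_hasProjectiveDimensionLE_zero _).2 hc
  have hepi : Epi (cokerπ i) := epi_of_surjective _ (cokerπ_surjective i)
  let s : coker i ⟶ self 𝒜 := Projective.factorThru (𝟙 _) (cokerπ i)
  have hs : s ≫ cokerπ i = 𝟙 _ := Projective.factorThru_comp _ _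
  let one : (self 𝒜).obj 0 := ⟨1, one_mem_intPiece rfl⟩
  -- The two sides agree modulo R_{≥1}, which is zero in degree 0.
  have h1 : s.app 0 ((cokerπ i).app 0 one) = one := by
    have h2 : (cokerπ i).app 0 (s.app 0 ((cokerπ i).app 0 one) - one) = 0 := by
      rw [map_sub, sub_eq_zero]
      exact congr_app hs 0 _
    obtain ⟨y, hy⟩ := (cokerπ_eq_zero_iff i 0 _).1 h2
    have hy0 : i.app 0 y = 0 := GSub.ι_app_mem (GSub.trunc (self 𝒜) 1) y (by norm_num)
    rw [hy0] at hy
    exact (sub_eq_zero.1 hy.symm)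
  rw [structureSheaf, ObjectProperty.SerreClassLocalization.isZero_obj_iff (quotientFunctor 𝒜)
    (torsion 𝒜)]
  refine torsion_of_bound (n := 1) fun l hl x => ?_
  obtain ⟨n, rfl⟩ := Int.eq_ofNat_of_zero_le (show 0 ≤ l by omega)
  have hj : (0 : ℤ) + n = n := zero_add _
  have hx : (self 𝒜).act hj one ⟨x.1, x.2⟩ = x := Subtype.ext (one_mul x.1)
  have hx0 : (cokerπ i).app n x = 0 := (cokerπ_eq_zero_iff i _ _).2
    ⟨⟨x, GSub.mem_trunc_of_le hl x⟩, rfl⟩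
  -- Since 1 = s(π(1)), linearity gives x = s(π(x)), and π kills positive degrees.
  calc x = (self 𝒜).act hj one ⟨x.1, x.2⟩ := hx.symm
    _ = (self 𝒜).act hj (s.app 0 ((cokerπ i).app 0 one)) ⟨x.1, x.2⟩ := by rw [h1]
    _ = s.app n ((cokerπ i).app n ((self 𝒜).act hj one ⟨x.1, x.2⟩)) := by
      rw [(cokerπ i).map_act, s.map_act]
    _ = 0 := by rw [hx, hx0, map_zero]

-- Adding one on the left avoids subtraction: for `d = 0` the inequality holds only when the
-- cohomological dimension is -∞, which is why that case needs the structure sheaf to be zero.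
variable (𝒜) in
theorem cohomologicalDimension_add_one_le {d : ℕ} (h : leftGlobalDimension R ≤ d) :
    cohomologicalDimension 𝒜 + 1 ≤ d := by
  cases d with
  | zero =>
    have hz := isZero_structureSheaf (𝒜 := 𝒜) h
    have : cohomologicalDimension 𝒜 = ⊥ := by
      refine sSup_eq_bot.2 ?_
      rintro _ ⟨i, rfl, Y, -, hY⟩
      refine (not_subsingleton_iff_nontrivial.2 hY (subsingleton_of_forall_eq 0 fun e => ?_)).elim
      rw [← Abelian.Ext.mk₀_id_comp e, hz.eq_of_src (𝟙 _) 0, Abelian.Ext.mk₀_zero,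
        Abelian.Ext.zero_comp]
    rw [this, WithBot.bot_add]
    exact bot_le
  | succ d =>
    have : cohomologicalDimension 𝒜 ≤ d := by
      refine sSup_le ?_
      rintro _ ⟨i, rfl, Y, -, hY⟩
      by_contra hi
      have hi' : d + 1 ≤ i := by
        by_contra hlt
        exact hi (by exact_mod_cast (show i ≤ d by omega))
      exact not_subsingleton_iff_nontrivial.2 hY
        (subsingleton_cohomology_of_leftGlobalDimension_le (by exact_mod_cast h) hi' Y)
    push_cast
    gcongr

end
end NCProj

open NCProj in
theorem mainTheorem4 {k : Type w} [Field k] {R : Type u} [Ring R] [Algebra k R]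
    (𝒜 : ℕ → Submodule k R) [GradedAlgebra 𝒜] [IsNoetherianRing Rᵐᵒᵖ] :
    (cohomologicalDimension 𝒜 < ⊤ →
      cohomologicalDimension 𝒜 =
        sSup {c : WithBot ℕ∞ | ∃ i : ℕ, c = i ∧ Nontrivial (gradedCohomology 𝒜 i (structureSheaf 𝒜))}) ∧
    (∀ d : ℕ, leftGlobalDimension R ≤ d → cohomologicalDimension 𝒜 + 1 ≤ d) :=
  ⟨cohomologicalDimension_eq 𝒜, fun _ => cohomologicalDimension_add_one_le 𝒜⟩
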